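/- Assume the Exponential Time Hypothesis (ETH) in the following form: there is $\delta>0$ such that no (deterministic) algorithm solves 3-SAT (CNF formulae with at most three literals per clause) in $O(2^{\delta n})$ time, where $n$ is the number of variables, and this holds even when restricted to formulae in which each variable appears in at most three clauses. Then there is a polynomial $p$ with $p(k)>0$ for all $k\in\mathbb N$ such that for every function $T:\mathbb N\to\mathbb N$ (in particular, every computable one) and every function $g:\mathbb N\to\mathbb R$ with $g(k)=o(k)$ as $k\to\infty$, no algorithm approximates $k$-DomSet to within a factor of $(\log_2 n)^{1/p(k)}$ in $T(k)\cdot n^{g(k)}$ time. That is, there is no algorithm which, on every input $(G,k)$ consisting of a graph $G$ with $n\ge 2$ vertices and an integer $k\ge 1$, halts within $T(k)\cdot n^{g(k)}$ steps and, whenever $G$ has a dominating set of size at most $k$, outputs a dominating set of $G$ of size at most $(\log_2 n)^{1/p(k)}\cdot k$. Here a dominating set of $G$ is a set $S$ of vertices such that every vertex outside $S$ has a neighbour in $S$. Algorithms are programs of a unit-cost random access machine with addition and truncated subtraction as its only arithmetic operations, a model that is polynomially equivalent to Turing machines. -/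

import Mathlib

open Asymptotics Filter

namespace DomETH

/-! ### The machine model

A random access machine, presented as structured programs.  A program uses finitely many
registers and finitely many zero-initialised arrays, all holding natural numbers.  The only
arithmetic operations are addition and truncated subtraction (no multiplication), each of them
and each memory access costing one step, so that the model is polynomially equivalent to
Turing machines. -/

/-- Memory contents: registers `reg x`, and array cells `arr a i`. -/
structure State where
  reg : ℕ → ℕ
  arr : ℕ → ℕ → ℕ

/-- Expressions: constants, registers, array cells (with computed index), sums, and truncated
differences. -/
inductive Expr where
  | const (c : ℕ) : Expr
  | var (x : ℕ) : Expr
  | read (a : ℕ) (i : Expr) : Expr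
  | add (e f : Expr) : Expr
  | sub (e f : Expr) : Expr

/-- The value of an expression. -/
def Expr.eval (s : State) : Expr → ℕ
  | .const c => c
  | .var x => s.reg x
  | .read a i => s.arr a (i.eval s)
  | .add e f => e.eval s + f.eval s
  | .sub e f => e.eval s - f.eval s

/-- The number of operations performed when an expression is evaluated. -/
def Expr.cost : Expr → ℕ
  | .const _ => 1
  | .var _ => 1
  | .read _ i => i.cost + 1
  | .add e f => e.cost + f.cost + 1
  | .sub e f => e.cost + f.cost + 1

/-- Programs. -/
inductive Program where
  | skip : Program
  /-- `x := e` -/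
  | assign (x : ℕ) (e : Expr) : Program
  /-- `a[i] := e` -/
  | write (a : ℕ) (i e : Expr) : Program
  /-- `P; Q` -/
  | seq (P Q : Program) : Program
  /-- `if e ≠ 0 then P else Q` -/
  | ite (e : Expr) (P Q : Program) : Program
  /-- `while e ≠ 0 do P` -/
  | loop (e : Expr) (P : Program) : Program

/-- The state after the assignment `x := v`. -/
def State.setReg (s : State) (x v : ℕ) : State :=
  { s with reg := Function.update s.reg x v }

/-- The state after the assignment `a[i] := v`. -/
def State.setArr (s : State) (a i v : ℕ) : State :=
  { s with arr := Function.update s.arr a (Function.update (s.arr a) i v) }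

/-- `Exec P s c s'`: the program `P`, started in state `s`, halts after exactly `c` steps in
state `s'`. -/
inductive Exec : Program → State → ℕ → State → Prop where
  | skip (s : State) : Exec .skip s 1 s
  | assign (s : State) (x : ℕ) (e : Expr) :
      Exec (.assign x e) s (e.cost + 1) (s.setReg x (e.eval s))
  | write (s : State) (a : ℕ) (i e : Expr) :
      Exec (.write a i e) s (i.cost + e.cost + 1) (s.setArr a (i.eval s) (e.eval s))
  | seq {P Q : Program} {s s' s'' : State} {c d : ℕ} :
      Exec P s c s' → Exec Q s' d s'' → Exec (.seq P Q) s (c + d) s''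
  | ite_true {e : Expr} {P Q : Program} {s s' : State} {c : ℕ} :
      e.eval s ≠ 0 → Exec P s c s' → Exec (.ite e P Q) s (e.cost + 1 + c) s'
  | ite_false {e : Expr} {P Q : Program} {s s' : State} {c : ℕ} :
      e.eval s = 0 → Exec Q s c s' → Exec (.ite e P Q) s (e.cost + 1 + c) s'
  | loop_done {e : Expr} {P : Program} {s : State} :
      e.eval s = 0 → Exec (.loop e P) s (e.cost + 1) s
  | loop_step {e : Expr} {P : Program} {s s' s'' : State} {c d : ℕ} :
      e.eval s ≠ 0 → Exec P s c s' → Exec (.loop e P) s' d s'' →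
        Exec (.loop e P) s (e.cost + 1 + c + d) s''

/-! ### 3-SAT and the Exponential Time Hypothesis -/

/-- A literal over `n` variables: a variable together with the truth value that satisfies it. -/
abbrev Literal (n : ℕ) : Type := Fin n × Bool

/-- A CNF formula over `n` variables, with pairwise distinct clauses of at most three literals
each. -/
structure CNF3 (n : ℕ) where
  clauses : List (List (Literal n))
  nodup : clauses.Nodup
  width : ∀ C ∈ clauses, C.length ≤ 3

/-- Some assignment makes at least one literal of every clause true. -/
def CNF3.Satisfiable {n : ℕ} (φ : CNF3 n) : Prop :=
  ∃ α : Fin n → Bool, ∀ C ∈ φ.clauses, ∃ l ∈ C, α l.1 = l.2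

/-- Each variable appears in at most three clauses. -/
def CNF3.AtMostThreeOccurrences {n : ℕ} (φ : CNF3 n) : Prop :=
  ∀ v : Fin n, (φ.clauses.filter (fun C => v ∈ C.map Prod.fst)).length ≤ 3

/-- The number that stands for a literal in an input array; it is positive. -/
def litCode {n : ℕ} (l : Literal n) : ℕ := 2 * l.1.val + (if l.2 then 1 else 2)

/-- The input for a formula: register `0` holds the number of variables, register `1` the number
of clauses, and cells `3 * j`, `3 * j + 1`, `3 * j + 2` of array `0` hold the literals of clause
`j`, with `0` for an unused position. -/
def CNF3.input {n : ℕ} (φ : CNF3 n) : State where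
  reg x := if x = 0 then n else if x = 1 then φ.clauses.length else 0
  arr a i :=
    if a = 0 then
      match φ.clauses[i / 3]? with
      | some C =>
        match C[i % 3]? with
        | some l => litCode l
        | none => 0
      | none => 0
    else 0

/-- `P` decides satisfiability of all 3-CNF formulae in the class `K`, within `t n` steps on
formulae with `n` variables.  The answer is yes if register `0` is nonzero at the end. -/
def Decides3SAT (P : Program) (K : ∀ n : ℕ, CNF3 n → Prop) (t : ℕ → ℝ) : Prop :=
  ∀ (n : ℕ) (φ : CNF3 n), K n φ →
    ∃ (c : ℕ) (s : State), Exec P φ.input c s ∧ (c : ℝ) ≤ t n ∧ (s.reg 0 ≠ 0 ↔ φ.Satisfiable)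

/-- The Exponential Time Hypothesis: for some `δ > 0`, no algorithm solves 3-SAT in time
`O(2 ^ (δ n))`, where `n` is the number of variables; moreover, this holds even when restricted to
formulae in which each variable appears in at most three clauses. -/
def ETH : Prop :=
  ∃ δ : ℝ, 0 < δ ∧
    (¬ ∃ (P : Program) (C : ℝ),
      Decides3SAT P (fun _ _ => True) (fun n => C * (2 : ℝ) ^ (δ * (n : ℝ)))) ∧
    (¬ ∃ (P : Program) (C : ℝ),
      Decides3SAT P (fun _ φ => φ.AtMostThreeOccurrences)
        (fun n => C * (2 : ℝ) ^ (δ * (n : ℝ))))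

/-! ### Approximating the dominating set problem -/

/-- Every vertex outside `S` has a neighbour in `S`. -/
def IsDominating {V : Type*} (G : SimpleGraph V) (S : Finset V) : Prop :=
  ∀ v, v ∉ S → ∃ u ∈ S, G.Adj u v

open Classical in
/-- The input for a graph `G` with vertices `0, …, n - 1` and a number `k`: register `0` holds
`n`, register `1` holds `k`, and array `0` holds the adjacency matrix of `G`, row by row. -/
noncomputable def domInput {n : ℕ} (G : SimpleGraph (Fin n)) (k : ℕ) : State where
  reg x := if x = 0 then n else if x = 1 then k else 0
  arr a i := if a = 0 ∧ ∃ u v : Fin n, G.Adj u v ∧ i = u.val * n + v.val then 1 else 0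

/-- The set of vertices that is output: those whose cell in array `1` is nonzero. -/
def outputSet (n : ℕ) (s : State) : Finset (Fin n) :=
  Finset.univ.filter (fun v => s.arr 1 v.val ≠ 0)

/-- `P` is an approximation algorithm for `k`-DomSet with ratio `ρ n k` and running time `t n k`:
on every graph `G` with `n ≥ 2` vertices and every `k ≥ 1` it halts within `t n k` steps, and
if `G` has a dominating set of size at most `k`, then it outputs a dominating set of size at most
`ρ n k * k`. -/
def ApproximatesDomSet (P : Program) (ρ t : ℕ → ℕ → ℝ) : Prop :=
  ∀ (n k : ℕ) (G : SimpleGraph (Fin n)), 2 ≤ n → 1 ≤ k →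
    ∃ (c : ℕ) (s : State), Exec P (domInput G k) c s ∧ (c : ℝ) ≤ t n k ∧
      ((∃ S : Finset (Fin n), IsDominating G S ∧ S.card ≤ k) →
        IsDominating G (outputSet n s) ∧ ((outputSet n s).card : ℝ) ≤ ρ n k * (k : ℝ))

end DomETH

/-! A dominating set algorithm would decide sparse 3-SAT too fast. Divide the `n` variables into `k`
groups of `w` variables each, where `w` is `n / k` plus a constant. A set vertex is a group together
with an assignment of it. An element is a pair of a hash function `i`, mapping assignments to `q`
values, and a function `z` that selects a clause for each `k`-tuple of hash values. A set vertex
`(j, x)` covers `(i, z)` if some tuple `a` has the hash value of `x` in position `j` and `x`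
satisfies clause `z a`.

Completeness (`Inst.exists_isDominating`): the restrictions of a model to the groups are `k`
vertices that dominate, since their hash values under `i` form a tuple `a`, and one of them
satisfies clause `z a`.

Soundness (`Inst.exists_isModel_of_dominating`): let `D` be dominating with `4 |D|² < q`. By
`card_collisions_le` and a union bound, more hash functions than `|D|` separate the members of `D`
within each group. For such a function, a tuple `a` picks at most one vertex of `D` per group, that
is, a partial assignment. If the formula is unsatisfiable, each of these misses a clause; letting `z
a` be that clause gives an element covered by nothing in `D`, which therefore lies in `D`. Distinct
hash functions give distinct elements, too many for `D`.

With `q` about `w ^ (1 / (2 k))` there are at most `√w` tuples, and sparsity gives at most `2 ^ √w`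
clauses, so the graph has `N ≤ 2 ^ (4 w)` vertices (`Inst.order_le`). For large `w`, an
approximation within `(log N) ^ (1 / (8 k + 1))` then satisfies `4 |D|² < q` (`four_mul_sq_lt`).
Building the graph and checking the output take `2 ^ (O(w))` steps with a constant independent of
`k`, and the approximation takes `T(k) 2 ^ (4 |g(k)| w)`. As `w` is about `n / k` and `g(k) = o(k)`,
some fixed `k` brings both below `O(2 ^ (δ n))`.

That the reduction is a program follows from the closure properties of `Feasible`; the given
algorithm runs as a guest in a disjoint part of the memory (`Exec.toGuest`). -/

namespace DomETH

/-! ### Running programs -/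

/-- Started in `s`, the program `P` halts within `K` steps in a state satisfying `Q`. -/
def Runs (P : Program) (s : State) (K : ℕ) (Q : State → Prop) : Prop :=
  ∃ c s', Exec P s c s' ∧ c ≤ K ∧ Q s'

theorem Runs.mono {P : Program} {s : State} {K K' : ℕ} {Q Q' : State → Prop}
    (h : Runs P s K Q) (hK : K ≤ K') (hQ : ∀ s', Q s' → Q' s') : Runs P s K' Q' := by
  obtain ⟨c, s', h1, h2, h3⟩ := h
  exact ⟨c, s', h1, h2.trans hK, hQ _ h3⟩

theorem Runs.seq {P P' : Program} {s : State} {K K' : ℕ} {R Q : State → Prop}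
    (h : Runs P s K R) (h' : ∀ s', R s' → Runs P' s' K' Q) :
    Runs (.seq P P') s (K + K') Q := by
  obtain ⟨c, s', h1, h2, h3⟩ := h
  obtain ⟨d, s'', g1, g2, g3⟩ := h' s' h3
  exact ⟨c + d, s'', .seq h1 g1, by omega, g3⟩

theorem Runs.assign {s : State} {x : ℕ} {e : Expr} {Q : State → Prop}
    (h : Q (s.setReg x (e.eval s))) : Runs (.assign x e) s (e.cost + 1) Q :=
  ⟨_, _, .assign s x e, le_rfl, h⟩

theorem Runs.write {s : State} {a : ℕ} {i e : Expr} {Q : State → Prop}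
    (h : Q (s.setArr a (i.eval s) (e.eval s))) :
    Runs (.write a i e) s (i.cost + e.cost + 1) Q :=
  ⟨_, _, .write s a i e, le_rfl, h⟩

/-- A loop that is executed `b` times, with an invariant indexed by the number of rounds. -/
theorem Runs.loop {e : Expr} {P : Program} {b K : ℕ} (Inv : ℕ → State → Prop)
    (guard : ∀ j s, j ≤ b → Inv j s → (e.eval s ≠ 0 ↔ j < b))
    (body : ∀ j s, j < b → Inv j s → Runs P s K (Inv (j + 1))) {s : State} (hs : Inv 0 s) :
    Runs (.loop e P) s ((b + 1) * (K + e.cost + 1)) (Inv b) := by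
  have key : ∀ r j s, j + r = b → Inv j s →
      Runs (.loop e P) s ((r + 1) * (K + e.cost + 1)) (Inv b) := by
    intro r
    induction r with
    | zero =>
      intro j s hj h
      have hj' : j = b := by omega
      subst hj'
      refine ⟨_, s, .loop_done ?_, by nlinarith, h⟩
      by_contra h0
      exact lt_irrefl _ ((guard _ s le_rfl h).1 h0)
    | succ r ih =>
      intro j s hj h
      obtain ⟨c, s', h1, h2, h3⟩ := body j s (by omega) h
      obtain ⟨d, s'', g1, g2, g3⟩ := ih (j + 1) s' (by omega) h3
      refine ⟨_, s'', .loop_step ((guard j s (by omega) h).2 (by omega)) h1 g1, ?_, g3⟩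
      nlinarith
  exact key b 0 s (by omega) hs

/-! ### A program as a guest in a larger memory -/

/-- The part of the memory made of the odd registers and the arrays with positive number. -/
def State.guest (s : State) : State where
  reg x := s.reg (2 * x + 1)
  arr a := s.arr (a + 1)

/-- The expression, referring to the guest part of the memory. -/
def Expr.toGuest : Expr → Expr
  | .const c => .const c
  | .var x => .var (2 * x + 1)
  | .read a i => .read (a + 1) i.toGuest
  | .add e f => .add e.toGuest f.toGuest
  | .sub e f => .sub e.toGuest f.toGuest

/-- The program, operating on the guest part of the memory. -/
def Program.toGuest : Program → Program
  | .skip => .skip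
  | .assign x e => .assign (2 * x + 1) e.toGuest
  | .write a i e => .write (a + 1) i.toGuest e.toGuest
  | .seq P Q => .seq P.toGuest Q.toGuest
  | .ite e P Q => .ite e.toGuest P.toGuest Q.toGuest
  | .loop e P => .loop e.toGuest P.toGuest

theorem Expr.eval_toGuest (s : State) (e : Expr) : e.toGuest.eval s = e.eval s.guest := by
  induction e <;> simp_all [Expr.toGuest, Expr.eval, State.guest]

theorem Expr.cost_toGuest (e : Expr) : e.toGuest.cost = e.cost := by
  induction e <;> simp_all [Expr.toGuest, Expr.cost]

theorem State.guest_setReg (s : State) (x v : ℕ) :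
    (s.setReg (2 * x + 1) v).guest = s.guest.setReg x v := by
  simp only [State.guest, State.setReg, State.mk.injEq, and_true]
  funext y
  by_cases h : y = x <;> simp [h]

theorem State.guest_setArr (s : State) (a i v : ℕ) :
    (s.setArr (a + 1) i v).guest = s.guest.setArr a i v := by
  simp only [State.guest, State.setArr, State.mk.injEq, true_and]
  funext b
  by_cases h : b = a <;> simp [h]

/-- The part of the memory outside the guest part is the same in both states. -/
def SameHost (s s' : State) : Prop :=
  (∀ x, s'.reg (2 * x) = s.reg (2 * x)) ∧ s'.arr 0 = s.arr 0

theorem SameHost.refl (s : State) : SameHost s s := ⟨fun _ => rfl, rfl⟩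

theorem SameHost.trans {s s' s'' : State} (h : SameHost s s') (h' : SameHost s' s'') :
    SameHost s s'' :=
  ⟨fun x => (h'.1 x).trans (h.1 x), h'.2.trans h.2⟩

/-- Renaming registers and arrays changes no cost and never touches an even register or array `0`,
so the data of the reduction survive the run of the approximation algorithm. -/
theorem Exec.toGuest {P : Program} {t t' : State} {c : ℕ} (h : Exec P t c t') :
    ∀ s : State, s.guest = t → ∃ s', Exec P.toGuest s c s' ∧ s'.guest = t' ∧ SameHost s s' := by
  induction h with
  | skip t => exact fun s hs => ⟨s, .skip s, hs, .refl s⟩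
  | assign t x e =>
    intro s hs
    subst hs
    refine ⟨s.setReg (2 * x + 1) (e.toGuest.eval s), e.cost_toGuest ▸ .assign s _ _, ?_,
      fun y => ?_, rfl⟩
    · rw [State.guest_setReg, Expr.eval_toGuest]
    · exact Function.update_of_ne (by omega) _ _
  | write t a i e =>
    intro s hs
    subst hs
    refine ⟨s.setArr (a + 1) (i.toGuest.eval s) (e.toGuest.eval s),
      e.cost_toGuest ▸ i.cost_toGuest ▸ .write s _ _ _, ?_, fun y => rfl, ?_⟩
    · rw [State.guest_setArr, Expr.eval_toGuest, Expr.eval_toGuest]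
    · simp [State.setArr]
  | seq _ _ ih1 ih2 =>
    intro s hs
    obtain ⟨s1, h1, g1, a1⟩ := ih1 s hs
    obtain ⟨s2, h2, g2, a2⟩ := ih2 s1 g1
    exact ⟨s2, .seq h1 h2, g2, a1.trans a2⟩
  | @ite_true e P Q t t' c h _ ih =>
    intro s hs
    obtain ⟨s1, h1, g1, a1⟩ := ih s hs
    exact ⟨s1, e.cost_toGuest ▸ .ite_true (by rwa [Expr.eval_toGuest, hs]) h1, g1, a1⟩
  | @ite_false e P Q t t' c h _ ih =>
    intro s hs
    obtain ⟨s1, h1, g1, a1⟩ := ih s hs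
    exact ⟨s1, e.cost_toGuest ▸ .ite_false (by rwa [Expr.eval_toGuest, hs]) h1, g1, a1⟩
  | @loop_done e P t h =>
    intro s hs
    exact ⟨s, e.cost_toGuest ▸ .loop_done (by rwa [Expr.eval_toGuest, hs]), hs, .refl s⟩
  | @loop_step e P t t' t'' c d h _ _ ih1 ih2 =>
    intro s hs
    obtain ⟨s1, h1, g1, a1⟩ := ih1 s hs
    obtain ⟨s2, h2, g2, a2⟩ := ih2 s1 g1
    exact ⟨s2, e.cost_toGuest ▸ .loop_step (by rwa [Expr.eval_toGuest, hs]) h1 h2, g2,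
      a1.trans a2⟩

/-! ### Functions computable in polynomial time -/

/-- A context describes memory contents that depend on a parameter `γ`: the values of finitely many
variables and a condition on the arrays (which may also restrict `γ`), together with the quantity
in which running times are measured. -/
structure Ctx (Γ : Type) where
  depth : ℕ
  val : Γ → ℕ → ℕ
  mem : Γ → (ℕ → ℕ → ℕ) → Prop
  size : Γ → ℕ

variable {Γ : Type}

/-- The context with one more variable, whose value is less than `b`. -/
def Ctx.push (X : Ctx Γ) (b : Γ → ℕ) : Ctx (Γ × ℕ) where
  depth := X.depth + 1
  val p i := if i = X.depth then p.2 else X.val p.1 i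
  mem p A := X.mem p.1 A ∧ p.2 < b p.1
  size p := X.size p.1

/-- The function is bounded by a power of the size of the context. -/
def Ctx.PolyBdd (X : Ctx Γ) (f : Γ → ℕ) : Prop :=
  ∃ C, ∀ γ A, X.mem γ A → f γ ≤ (X.size γ + 2) ^ C

namespace Ctx.PolyBdd

variable {X : Ctx Γ} {f g : Γ → ℕ}

theorem mono (hg : X.PolyBdd g) (h : ∀ γ A, X.mem γ A → f γ ≤ g γ) : X.PolyBdd f := by
  obtain ⟨C, hC⟩ := hg
  exact ⟨C, fun γ A hA => (h γ A hA).trans (hC γ A hA)⟩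

theorem const (c : ℕ) : X.PolyBdd (fun _ => c) :=
  ⟨c, fun γ _ _ => (Nat.lt_two_pow_self).le.trans (Nat.pow_le_pow_left (by omega) _)⟩

theorem size : X.PolyBdd X.size := ⟨1, fun γ _ _ => by simp⟩

theorem mul (hf : X.PolyBdd f) (hg : X.PolyBdd g) : X.PolyBdd (fun γ => f γ * g γ) := by
  obtain ⟨C, hC⟩ := hf
  obtain ⟨D, hD⟩ := hg
  exact ⟨C + D, fun γ A hA => by
    rw [pow_add]; exact Nat.mul_le_mul (hC γ A hA) (hD γ A hA)⟩

theorem add (hf : X.PolyBdd f) (hg : X.PolyBdd g) : X.PolyBdd (fun γ => f γ + g γ) := by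
  obtain ⟨C, hC⟩ := hf
  obtain ⟨D, hD⟩ := hg
  refine ⟨C + D + 1, fun γ A hA => ?_⟩
  have h1 : (X.size γ + 2) ^ C ≤ (X.size γ + 2) ^ (C + D) :=
    Nat.pow_le_pow_right (by omega) (by omega)
  have h2 : (X.size γ + 2) ^ D ≤ (X.size γ + 2) ^ (C + D) :=
    Nat.pow_le_pow_right (by omega) (by omega)
  have h3 := hC γ A hA
  have h4 := hD γ A hA
  rw [pow_succ]
  nlinarith

theorem comp_fst {b : Γ → ℕ} (hf : X.PolyBdd f) : (X.push b).PolyBdd (fun p => f p.1) := by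
  obtain ⟨C, hC⟩ := hf
  exact ⟨C, fun p A hA => hC p.1 A hA.1⟩

theorem snd {b : Γ → ℕ} (hb : X.PolyBdd b) : (X.push b).PolyBdd (fun p => p.2) := by
  obtain ⟨C, hC⟩ := hb
  exact ⟨C, fun p A hA => hA.2.le.trans (hC p.1 A hA.1)⟩

end Ctx.PolyBdd

/-- The state `s` matches the context at `γ`, where variable `i` is held in register
`2 * lay i`. -/
def Ctx.Holds (X : Ctx Γ) (lay : ℕ → ℕ) (γ : Γ) (s : State) : Prop :=
  (∀ i < X.depth, s.reg (2 * lay i) = X.val γ i) ∧ X.mem γ s.arr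

/-- The states differ at most in the even registers from `2 * e` on. -/
def SameBelow (e : ℕ) (s s' : State) : Prop :=
  (∀ x, x < 2 * e ∨ x % 2 = 1 → s'.reg x = s.reg x) ∧ s'.arr = s.arr

theorem SameBelow.refl (e : ℕ) (s : State) : SameBelow e s s := ⟨fun _ _ => rfl, rfl⟩

theorem SameBelow.trans {e e' : ℕ} {s s' s'' : State} (h : SameBelow e s s')
    (h' : SameBelow e' s' s'') (he : e ≤ e') : SameBelow e s s'' :=
  ⟨fun x hx => (h'.1 x (by omega)).trans (h.1 x hx), h'.2.trans h.2⟩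

theorem SameBelow.setReg {e e' : ℕ} {s s' : State} (h : SameBelow e s s') (v : ℕ)
    (he : e ≤ e') : SameBelow e s (s'.setReg (2 * e') v) :=
  ⟨fun x hx => (Function.update_of_ne (by omega) _ _).trans (h.1 x hx), h.2⟩

theorem SameBelow.reg {e : ℕ} {s s' : State} (h : SameBelow e s s') {y : ℕ} (hy : y < e) :
    s'.reg (2 * y) = s.reg (2 * y) := h.1 _ (Or.inl (by omega))

theorem Ctx.Holds.of_sameBelow {X : Ctx Γ} {lay : ℕ → ℕ} {γ : Γ} {s s' : State} {e : ℕ}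
    (h : X.Holds lay γ s) (hl : ∀ i < X.depth, lay i < e) (hs : SameBelow e s s') :
    X.Holds lay γ s' :=
  ⟨fun i hi => (hs.reg (hl i hi)).trans (h.1 i hi), by rw [hs.2]; exact h.2⟩

theorem Ctx.Holds.push {X : Ctx Γ} {lay : ℕ → ℕ} {γ : Γ} {s : State} {b : Γ → ℕ} {e j : ℕ}
    (h : X.Holds lay γ s) (hj : s.reg (2 * e) = j) (hb : j < b γ) :
    (X.push b).Holds (Function.update lay X.depth e) (γ, j) s := by
  refine ⟨fun i hi => ?_, h.2, hb⟩
  by_cases hd : i = X.depth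
  · simp [hd, Ctx.push, hj]
  · have hi' : i < X.depth := by
      change i < X.depth + 1 at hi
      omega
    simp [hd, Ctx.push, h.1 i hi']

theorem Ctx.lay_push {X : Ctx Γ} {lay : ℕ → ℕ} {e e' : ℕ} (b : Γ → ℕ)
    (hl : ∀ i < X.depth, lay i < e) (he : e' < e) :
    ∀ i < (X.push b).depth, Function.update lay X.depth e' i < e := by
  intro i hi
  by_cases hd : i = X.depth
  · simpa [hd] using he
  · have hi' : i < X.depth := by
      change i < X.depth + 1 at hi
      omega
    simpa [hd] using hl i hi'

/-- `P` leaves `f γ` in register `2 * e`, changing nothing but even registers from there on, within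
`c γ` steps. -/
def Evaluates (X : Ctx Γ) (f c : Γ → ℕ) (lay : ℕ → ℕ) (e : ℕ) (P : Program) : Prop :=
  ∀ γ s, X.Holds lay γ s → Runs P s (c γ) (fun s' => s'.reg (2 * e) = f γ ∧ SameBelow e s s')

/-- The function is computable in time polynomial in the size of the context, and so are its
values. -/
def Feasible (X : Ctx Γ) (f : Γ → ℕ) : Prop :=
  X.PolyBdd f ∧ ∃ c, X.PolyBdd c ∧
    -- The registers are quantified after the cost, so subprograms can be moved to fresh registers
    -- without affecting the time bound.
    ∀ lay e, (∀ i < X.depth, lay i < e) → ∃ P, Evaluates X f c lay e P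

/-! ### Composition and bounded primitive recursion -/

namespace Feasible

variable {X : Ctx Γ} {f g : Γ → ℕ}

theorem congr (hf : Feasible X f) (h : ∀ γ A, X.mem γ A → g γ = f γ) : Feasible X g := by
  obtain ⟨hb, c, hc, hP⟩ := hf
  refine ⟨hb.mono fun γ A hA => (h γ A hA).le, c, hc, fun lay e he => ?_⟩
  obtain ⟨P, hP⟩ := hP lay e he
  refine ⟨P, fun γ s hs => (hP γ s hs).mono le_rfl fun s' h' => ⟨?_, h'.2⟩⟩
  rw [h'.1, h γ _ hs.2]

theorem of_expr (hb : X.PolyBdd f) (E : (ℕ → ℕ) → Expr) (k : ℕ) (hk : ∀ lay, (E lay).cost ≤ k)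
    (hE : ∀ lay γ s, X.Holds lay γ s → (E lay).eval s = f γ) : Feasible X f := by
  refine ⟨hb, fun _ => k + 1, .const _, fun lay e he => ⟨.assign (2 * e) (E lay), fun γ s hs => ?_⟩⟩
  refine Runs.mono (Q := fun s' => s'.reg (2 * e) = f γ ∧ SameBelow e s s') (Runs.assign ?_)
    (Nat.add_le_add_right (hk lay) 1) fun _ h => h
  exact ⟨by simp [State.setReg, hE lay γ s hs], (SameBelow.refl e s).setReg _ le_rfl⟩

theorem const (c : ℕ) : Feasible X (fun _ => c) :=
  of_expr (.const c) (fun _ => .const c) 1 (fun _ => le_rfl) fun _ _ _ _ => rfl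

theorem var (i : ℕ) (hi : i < X.depth) (hb : X.PolyBdd f)
    (h : ∀ γ A, X.mem γ A → X.val γ i = f γ) : Feasible X f :=
  of_expr hb (fun lay => .var (2 * lay i)) 1 (fun _ => le_rfl)
    fun _ γ _ hs => (hs.1 i hi).trans (h γ _ hs.2)

theorem snd {b : Γ → ℕ} (hb : X.PolyBdd b) : Feasible (X.push b) (fun p => p.2) :=
  var X.depth (Nat.lt_succ_self _) hb.snd fun p _ _ => by simp [Ctx.push]

theorem comp_fst {b : Γ → ℕ} (hf : Feasible X f) : Feasible (X.push b) (fun p => f p.1) := by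
  obtain ⟨hb, c, hc, hP⟩ := hf
  refine ⟨hb.comp_fst, fun p => c p.1, hc.comp_fst, fun lay e he => ?_⟩
  obtain ⟨P, hP⟩ := hP lay e fun i hi => he i (Nat.lt_succ_of_lt hi)
  refine ⟨P, fun p s hs => hP p.1 s ⟨fun i hi => ?_, hs.2.1⟩⟩
  rw [hs.1 i (Nat.lt_succ_of_lt hi)]
  simp [Ctx.push, hi.ne]

/-- A further operation applied to a computed value. -/
theorem comp_expr (hf : Feasible X f) (hb : X.PolyBdd g) (E : ℕ → Expr) (k : ℕ)
    (hk : ∀ x, (E x).cost ≤ k)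
    (hE : ∀ lay γ s x, X.Holds lay γ s → s.reg x = f γ → (E x).eval s = g γ) :
    Feasible X g := by
  obtain ⟨-, c, hc, hP⟩ := hf
  refine ⟨hb, fun γ => c γ + (k + 1), hc.add (.const _), fun lay e he => ?_⟩
  obtain ⟨P, hP⟩ := hP lay e he
  refine ⟨.seq P (.assign (2 * e) (E (2 * e))), fun γ s hs => (hP γ s hs).seq fun s' h' => ?_⟩
  refine Runs.mono (Q := fun s' => s'.reg (2 * e) = g γ ∧ SameBelow e s s') (Runs.assign ?_)
    (Nat.add_le_add_right (hk _) 1) fun _ h => h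
  exact ⟨by simp [State.setReg, hE lay γ s' _ (hs.of_sameBelow he h'.2) h'.1],
    h'.2.setReg _ le_rfl⟩

/-- An operation applied to two computed values. -/
theorem comp_expr₂ {h : Γ → ℕ} (hf : Feasible X f) (hg : Feasible X g) (hb : X.PolyBdd h)
    (E : ℕ → ℕ → Expr) (k : ℕ) (hk : ∀ x y, (E x y).cost ≤ k)
    (hE : ∀ γ (s : State) x y, s.reg x = f γ → s.reg y = g γ → (E x y).eval s = h γ) :
    Feasible X h := by
  obtain ⟨-, c, hc, hP⟩ := hf
  obtain ⟨-, d, hd, hQ⟩ := hg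
  refine ⟨hb, fun γ => c γ + (d γ + (k + 1)), hc.add (hd.add (.const _)), fun lay e he => ?_⟩
  obtain ⟨P, hP⟩ := hP lay e he
  have he' : ∀ i < X.depth, lay i < e + 1 := fun i hi => (he i hi).trans (Nat.lt_succ_self e)
  obtain ⟨Q, hQ⟩ := hQ lay (e + 1) he'
  refine ⟨.seq P (.seq Q (.assign (2 * e) (E (2 * e) (2 * (e + 1))))), fun γ s hs =>
    (hP γ s hs).seq fun s' h' => (hQ γ s' (hs.of_sameBelow he h'.2)).seq fun s'' h'' => ?_⟩
  refine Runs.mono (Q := fun s' => s'.reg (2 * e) = h γ ∧ SameBelow e s s') (Runs.assign ?_)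
    (Nat.add_le_add_right (hk _ _) 1) fun _ h => h
  refine ⟨?_, (h'.2.trans h''.2 (Nat.le_succ e)).setReg _ le_rfl⟩
  rw [hE γ s'' _ _ ((h''.2.reg (Nat.lt_succ_self e)).trans h'.1) h''.1]
  simp [State.setReg]

theorem add (hf : Feasible X f) (hg : Feasible X g) : Feasible X (fun γ => f γ + g γ) :=
  hf.comp_expr₂ hg (hf.1.add hg.1) (fun x y => .add (.var x) (.var y)) 3 (fun _ _ => le_rfl)
    fun γ s x y hx hy => by simp [Expr.eval, hx, hy]

theorem sub (hf : Feasible X f) (hg : Feasible X g) : Feasible X (fun γ => f γ - g γ) :=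
  hf.comp_expr₂ hg (hf.1.mono fun _ _ _ => Nat.sub_le _ _)
    (fun x y => .sub (.var x) (.var y)) 3 (fun _ _ => le_rfl)
    fun γ s x y hx hy => by simp [Expr.eval, hx, hy]

/-- Primitive recursion, provided that all intermediate values are bounded. -/
theorem natRec {b i B : Γ → ℕ} {F : Γ → ℕ → ℕ → ℕ} (hb : Feasible X b) (hi : Feasible X i)
    (hF : Feasible ((X.push b).push fun p => B p.1) (fun p => F p.1.1 p.1.2 p.2))
    (hBB : X.PolyBdd B)
    (hB : ∀ γ A, X.mem γ A → ∀ j ≤ b γ, Nat.rec (motive := fun _ => ℕ) (i γ) (F γ) j < B γ) :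
    Feasible X (fun γ => Nat.rec (motive := fun _ => ℕ) (i γ) (F γ) (b γ)) := by
  refine ⟨hBB.mono fun γ A hA => (hB γ A hA _ le_rfl).le, ?_⟩
  obtain ⟨hbb, c, hc, hP⟩ := hb
  obtain ⟨-, d, hd, hQ⟩ := hi
  obtain ⟨-, cF, ⟨C, hC⟩, hR⟩ := hF
  refine ⟨fun γ => c γ + (d γ + (2 + ((b γ + 1) * (((X.size γ + 2) ^ C + (2 + 4)) + 3 + 1) + 2))),
    hc.add (hd.add (.add (.const 2) (.add (.mul (hbb.add (.const 1)) (.add (.add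
      (.add ⟨C, fun _ _ _ => le_rfl⟩ (.const _)) (.const _)) (.const _))) (.const 2)))),
    fun lay e he => ?_⟩
  have he1 : ∀ i < X.depth, lay i < e + 1 := fun i hi => (he i hi).trans (by omega)
  have he3 : ∀ i < X.depth, lay i < e + 3 := fun i hi => (he i hi).trans (by omega)
  obtain ⟨P, hP⟩ := hP lay e he
  obtain ⟨Q, hQ⟩ := hQ lay (e + 1) he1
  obtain ⟨R, hR⟩ := hR
    (Function.update (Function.update lay X.depth (e + 2)) (X.push b).depth (e + 1)) (e + 3)
    (Ctx.lay_push _ (Ctx.lay_push _ he3 (by omega)) (by omega))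
  -- Register `2 * e` holds the number of rounds, `2 * (e + 1)` the accumulator and `2 * (e + 2)`
  -- the counter; the body computes from `2 * (e + 3)` on.
  refine ⟨.seq P (.seq Q (.seq (.assign (2 * (e + 2)) (.const 0)) (.seq
    (.loop (.sub (.var (2 * e)) (.var (2 * (e + 2))))
      (.seq R (.seq (.assign (2 * (e + 1)) (.var (2 * (e + 3))))
        (.assign (2 * (e + 2)) (.add (.var (2 * (e + 2))) (.const 1))))))
    (.assign (2 * e) (.var (2 * (e + 1))))))), fun γ s hs =>
    (hP γ s hs).seq fun s1 h1 => (hQ γ s1 (hs.of_sameBelow he h1.2)).seq fun s2 h2 => ?_⟩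
  have hbs : s2.reg (2 * e) = b γ := (h2.2.reg (Nat.lt_succ_self e)).trans h1.1
  let Inv : ℕ → State → Prop := fun j t => t.reg (2 * e) = b γ ∧ t.reg (2 * (e + 2)) = j ∧
    t.reg (2 * (e + 1)) = Nat.rec (motive := fun _ => ℕ) (i γ) (F γ) j ∧ SameBelow e s t
  refine Runs.seq (R := Inv 0) (Runs.assign ?_) fun s3 h3 => Runs.seq (R := Inv (b γ)) ?_ ?_
  · refine ⟨?_, by simp [State.setReg, Expr.eval], ?_,
      (h1.2.trans h2.2 (Nat.le_succ e)).setReg _ (by omega)⟩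
    · simp [State.setReg, hbs]
    · simp [State.setReg, ← h2.1]
  · refine Runs.loop Inv (fun j t _ ht => ?_) (fun j t hj ht => ?_) h3
    · simp only [Expr.eval, ht.1, ht.2.1]
      omega
    · obtain ⟨t1, t2, t3, t4⟩ := ht
      -- The cost of the body is controlled only for accumulators below `B`, so this bound is what
      -- licenses running it.
      have hB' := hB γ _ hs.2 j hj.le
      have hh := (((hs.of_sameBelow he t4).push t2 hj).push (b := fun p => B p.1) t3 hB')
      refine ((hR _ t hh).mono (hC _ _ hh.2) fun _ h => h).seq fun t' h' => ?_
      refine Runs.seq (R := fun t => t.reg (2 * e) = b γ ∧ t.reg (2 * (e + 2)) = j ∧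
        t.reg (2 * (e + 1)) = Nat.rec (motive := fun _ => ℕ) (i γ) (F γ) (j + 1) ∧
        SameBelow e s t) (K' := 4) (Runs.assign ⟨?_, ?_, ?_, ?_⟩) fun u hu =>
          Runs.assign ⟨?_, ?_, ?_, ?_⟩
      · simp only [State.setReg]
        rw [Function.update_of_ne (by omega), h'.2.reg (by omega), t1]
      · simp only [State.setReg]
        rw [Function.update_of_ne (by omega), h'.2.reg (by omega), t2]
      · simp [State.setReg, Expr.eval, h'.1]
      · exact (t4.trans h'.2 (by omega)).setReg _ (by omega)
      · simp only [State.setReg]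
        rw [Function.update_of_ne (by omega), hu.1]
      · simp [State.setReg, Expr.eval, hu.2.1]
      · simp only [State.setReg]
        rw [Function.update_of_ne (by omega), hu.2.2.1]
      · exact hu.2.2.2.setReg _ (by omega)
  · intro u hu
    exact Runs.assign ⟨by simp [State.setReg, Expr.eval, hu.2.2.1], hu.2.2.2.setReg _ le_rfl⟩

end Feasible
-- Decidable predicates, bounded quantifiers and arithmetic
open Classical in
/-- The predicate is decidable in time polynomial in the size of the context. -/
def FeasiblePred (X : Ctx Γ) (p : Γ → Prop) : Prop := Feasible X (fun γ => if p γ then 1 else 0)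

theorem FeasiblePred.congr {X : Ctx Γ} {p q : Γ → Prop} (hq : FeasiblePred X q)
    (h : ∀ γ A, X.mem γ A → (p γ ↔ q γ)) : FeasiblePred X p := by
  classical exact Feasible.congr hq fun γ A hA => if_congr (h γ A hA) rfl rfl

namespace Feasible

variable {X : Ctx Γ} {f g : Γ → ℕ}

theorem sum {b : Γ → ℕ} {F : Γ → ℕ → ℕ} (hb : Feasible X b)
    (hF : Feasible (X.push b) (fun p => F p.1 p.2)) :
    Feasible X (fun γ => ∑ j ∈ Finset.range (b γ), F γ j) := by
  obtain ⟨C, hC⟩ := hF.1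
  have hB : X.PolyBdd (fun γ => b γ * (X.size γ + 2) ^ C + 1) :=
    (hb.1.mul ⟨C, fun _ _ _ => le_rfl⟩).add (.const 1)
  have hrec : ∀ γ j, Nat.rec (motive := fun _ => ℕ) 0 (fun j acc => acc + F γ j) j =
      ∑ j ∈ Finset.range j, F γ j := by
    intro γ j
    induction j with
    | zero => simp
    | succ j ih => rw [Finset.sum_range_succ, ← ih]
  refine (natRec (F := fun γ j acc => acc + F γ j) hb (const 0)
    ((snd hB.comp_fst).add hF.comp_fst) hB fun γ A hA j hj => ?_).congr fun γ A hA => (hrec γ _).symm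
  rw [hrec]
  have h1 : ∑ i ∈ Finset.range j, F γ i ≤ ∑ i ∈ Finset.range j, (X.size γ + 2) ^ C :=
    Finset.sum_le_sum fun i hi => hC (γ, i) A ⟨hA, (Finset.mem_range.1 hi).trans_le hj⟩
  rw [Finset.sum_const, Finset.card_range, smul_eq_mul] at h1
  exact Nat.lt_succ_of_le (h1.trans (Nat.mul_le_mul_right _ hj))

/-- Repeated addition; affordable because the number of summands is polynomially bounded. -/
theorem mul (hf : Feasible X f) (hg : Feasible X g) : Feasible X (fun γ => f γ * g γ) :=
  (hf.sum (F := fun γ _ => g γ) hg.comp_fst).congr fun γ _ _ => by simp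

theorem lt (hf : Feasible X f) (hg : Feasible X g) : FeasiblePred X (fun γ => f γ < g γ) :=
  -- With truncated subtraction, `1 - (1 - d)` is the indicator of `d > 0`.
  ((const 1).sub ((const 1).sub (hg.sub hf))).congr fun γ _ _ => by
    by_cases h : f γ < g γ
    · simp only [h, if_true]; omega
    · simp only [h, if_false]; omega

end Feasible

namespace FeasiblePred

variable {X : Ctx Γ} {p q : Γ → Prop}

theorem not (hp : FeasiblePred X p) : FeasiblePred X (fun γ => ¬ p γ) :=
  ((Feasible.const 1).sub hp).congr fun γ _ _ => by by_cases h : p γ <;> simp [h]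

theorem and (hp : FeasiblePred X p) (hq : FeasiblePred X q) :
    FeasiblePred X (fun γ => p γ ∧ q γ) :=
  (Feasible.mul hp hq).congr fun γ _ _ => by by_cases h : p γ <;> by_cases h' : q γ <;> simp [h, h']

theorem or (hp : FeasiblePred X p) (hq : FeasiblePred X q) :
    FeasiblePred X (fun γ => p γ ∨ q γ) :=
  (hp.not.and hq.not).not.congr fun γ _ _ => by tauto

/-- Bounded existential quantification. -/
theorem bex {b : Γ → ℕ} {p : Γ → ℕ → Prop} (hb : Feasible X b)
    (hp : FeasiblePred (X.push b) (fun x => p x.1 x.2)) :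
    FeasiblePred X (fun γ => ∃ j < b γ, p γ j) := by
  classical
  refine (Feasible.lt (.const 0) (hb.sum (F := fun γ j => if p γ j then 1 else 0)
    (Feasible.congr hp fun _ _ _ => by congr))).congr fun γ _ _ => ?_
  rw [Finset.sum_pos_iff]
  constructor
  · rintro ⟨j, hj, h⟩
    exact ⟨j, Finset.mem_range.2 hj, by simp [h]⟩
  · rintro ⟨j, hj, h⟩
    exact ⟨j, Finset.mem_range.1 hj, by by_contra h'; simp [h'] at h⟩

/-- Bounded universal quantification. -/
theorem ball {b : Γ → ℕ} {p : Γ → ℕ → Prop} (hb : Feasible X b)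
    (hp : FeasiblePred (X.push b) (fun x => p x.1 x.2)) :
    FeasiblePred X (fun γ => ∀ j < b γ, p γ j) :=
  (bex (p := fun γ j => ¬ p γ j) hb hp.not).not.congr fun γ _ _ => by push Not; rfl

end FeasiblePred

namespace Feasible

variable {X : Ctx Γ} {f g : Γ → ℕ}

theorem le (hf : Feasible X f) (hg : Feasible X g) : FeasiblePred X (fun γ => f γ ≤ g γ) :=
  (hg.lt hf).not.congr fun _ _ _ => not_lt.symm

theorem eq (hf : Feasible X f) (hg : Feasible X g) : FeasiblePred X (fun γ => f γ = g γ) :=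
  ((hf.le hg).and (hg.le hf)).congr fun _ _ _ => le_antisymm_iff

theorem ite {p : Γ → Prop} [DecidablePred p] (hp : FeasiblePred X p) (hf : Feasible X f)
    (hg : Feasible X g) : Feasible X (fun γ => if p γ then f γ else g γ) :=
  ((mul hp hf).add (mul hp.not hg)).congr fun γ _ _ => by by_cases h : p γ <;> simp [h]

/-- The number of `j` below a bound with a given property. -/
theorem count {b : Γ → ℕ} {p : Γ → ℕ → Prop} [∀ γ, DecidablePred (p γ)] (hb : Feasible X b)
    (hp : FeasiblePred (X.push b) (fun x => p x.1 x.2)) :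
    Feasible X (fun γ => ((Finset.range (b γ)).filter (p γ)).card) :=
  (hb.sum (F := fun γ j => if p γ j then 1 else 0)
    (Feasible.congr hp fun _ _ _ => by congr)).congr fun γ _ _ => by
      rw [Finset.card_filter]

/-- The quotient counts the positive multiples of `g γ` up to `f γ`; the condition `0 < g γ`
reproduces the value `0` of division by zero. -/
theorem div (hf : Feasible X f) (hg : Feasible X g) : Feasible X (fun γ => f γ / g γ) := by
  refine (count (p := fun γ j => 0 < g γ ∧ (j + 1) * g γ ≤ f γ) hf
    (((const 0).lt hg.comp_fst).and ((((snd hf.1).add (const 1)).mul hg.comp_fst).le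
      hf.comp_fst))).congr fun γ _ _ => ?_
  rcases Nat.eq_zero_or_pos (g γ) with h | h
  · simp [h]
  · have : (Finset.range (f γ)).filter (fun j => 0 < g γ ∧ (j + 1) * g γ ≤ f γ) =
        Finset.range (f γ / g γ) := by
      ext j
      have := Nat.div_le_self (f γ) (g γ)
      simp only [Finset.mem_filter, Finset.mem_range, h, true_and, ← Nat.le_div_iff_mul_le h]
      omega
    rw [this, Finset.card_range]

theorem mod (hf : Feasible X f) (hg : Feasible X g) : Feasible X (fun γ => f γ % g γ) :=
  (hf.sub (hg.mul (hf.div hg))).congr fun _ _ _ => Nat.mod_eq_sub_mul_div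

theorem pow (hf : Feasible X f) (hg : Feasible X g) (h : X.PolyBdd (fun γ => f γ ^ g γ)) :
    Feasible X (fun γ => f γ ^ g γ) := by
  have hrec : ∀ γ j, Nat.rec (motive := fun _ => ℕ) 1 (fun _ acc => acc * f γ) j = f γ ^ j := by
    intro γ j
    induction j with
    | zero => simp
    | succ j ih => rw [pow_succ, ← ih]
  -- The recursion starts at `1`, which exceeds the final value when the base is `0`; hence `2`
  -- rather than `1`.
  have hB : X.PolyBdd (fun γ => f γ ^ g γ + 2) := h.add (.const 2)
  refine (natRec (F := fun γ _ acc => acc * f γ) hg (const 1)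
    ((snd hB.comp_fst).mul hf.comp_fst.comp_fst) hB fun γ A hA j hj => ?_).congr
      fun γ A hA => (hrec γ _).symm
  rw [hrec]
  rcases Nat.eq_zero_or_pos (f γ) with h0 | h0
  · rcases Nat.eq_zero_or_pos j with h1 | h1
    · rw [h1, pow_zero]
      omega
    · simp [h0, h1.ne']
  · have := Nat.pow_le_pow_right h0 hj
    omega

end Feasible
/-! ### Arithmetic tools -/

/-- The least prime larger than `N`, found by testing the numbers from `N + 1` on. -/
def primeSearch (N : ℕ) : ℕ :=
  Nat.rec (motive := fun _ => ℕ) (N + 1) (fun _ a => if a.Prime then a else a + 1) N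

theorem primeSearch_aux {N P : ℕ} (hP : P.Prime) (hN : N < P) (j : ℕ) :
    let a := Nat.rec (motive := fun _ => ℕ) (N + 1) (fun _ a => if a.Prime then a else a + 1) j
    N < a ∧ a ≤ P ∧ (a.Prime ∨ a = N + 1 + j) := by
  induction j with
  | zero => exact ⟨Nat.lt_succ_self N, hN, Or.inr rfl⟩
  | succ j ih =>
    intro a
    obtain ⟨h1, h2, h3⟩ := ih
    set a' := Nat.rec (motive := fun _ => ℕ) (N + 1) (fun _ a => if a.Prime then a else a + 1) j
    have ha : a = if a'.Prime then a' else a' + 1 := rfl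
    by_cases h : a'.Prime
    · rw [ha, if_pos h]
      exact ⟨h1, h2, Or.inl h⟩
    · rw [ha, if_neg h]
      have : a' ≠ P := fun h' => h (h' ▸ hP)
      have := h3.resolve_left h
      omega

theorem primeSearch_iterate_le {N : ℕ} (hN : 1 ≤ N) (j : ℕ) :
    Nat.rec (motive := fun _ => ℕ) (N + 1) (fun _ a => if a.Prime then a else a + 1) j ≤ 2 * N := by
  obtain ⟨P, hP, h1, h2⟩ := Nat.exists_prime_lt_and_le_two_mul N (by omega)
  exact (primeSearch_aux hP h1 j).2.1.trans h2

/-- Bertrand's postulate gives a prime up to `2 * N`, which the search cannot pass; a search still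
moving after `N` rounds would stand at `2 * N + 1`. -/
theorem primeSearch_spec {N : ℕ} (hN : 1 ≤ N) :
    (primeSearch N).Prime ∧ N < primeSearch N ∧ primeSearch N ≤ 2 * N := by
  obtain ⟨P, hP, h1, h2⟩ := Nat.exists_prime_lt_and_le_two_mul N (by omega)
  have h := primeSearch_aux hP h1 N
  change N < primeSearch N ∧ primeSearch N ≤ P ∧ ((primeSearch N).Prime ∨ _ = _) at h
  obtain ⟨h3, h4, h5⟩ := h
  refine ⟨h5.resolve_right fun h => ?_, h3, h4.trans h2⟩
  change primeSearch N = _ at h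
  omega

/-- The integer part of the `2 k`-th root of `w`. -/
def rootSearch (k w : ℕ) : ℕ :=
  Nat.rec (motive := fun _ => ℕ) 1 (fun _ a => if (a + 1) ^ (2 * k) ≤ w then a + 1 else a) w

theorem rootSearch_aux {k w : ℕ} (hw : 1 ≤ w) (j : ℕ) :
    let a := Nat.rec (motive := fun _ => ℕ) 1
      (fun _ a => if (a + 1) ^ (2 * k) ≤ w then a + 1 else a) j
    1 ≤ a ∧ a ^ (2 * k) ≤ w ∧ (w < (a + 1) ^ (2 * k) ∨ a = 1 + j) := by
  induction j with
  | zero => exact ⟨le_rfl, by simpa using hw, Or.inr rfl⟩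
  | succ j ih =>
    intro a
    obtain ⟨h1, h2, h3⟩ := ih
    set a' := Nat.rec (motive := fun _ => ℕ) 1
      (fun _ a => if (a + 1) ^ (2 * k) ≤ w then a + 1 else a) j
    have ha : a = if (a' + 1) ^ (2 * k) ≤ w then a' + 1 else a' := rfl
    by_cases h : (a' + 1) ^ (2 * k) ≤ w
    · rw [ha, if_pos h]
      have := h3.resolve_left (not_lt.2 h)
      exact ⟨by omega, h, Or.inr (by omega)⟩
    · rw [ha, if_neg h]
      exact ⟨h1, h2, Or.inl (not_le.1 h)⟩

theorem le_of_pow_two_mul_le {a k w : ℕ} (hk : 1 ≤ k) (h : a ^ (2 * k) ≤ w) : a ≤ w :=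
  (Nat.le_self_pow (by omega) a).trans h

/-- A search that never stopped would end at `w + 1`, but a value whose power is at most `w` is
itself at most `w`. -/
theorem rootSearch_spec {k w : ℕ} (hk : 1 ≤ k) (hw : 1 ≤ w) :
    1 ≤ rootSearch k w ∧ rootSearch k w ^ (2 * k) ≤ w ∧ w < (rootSearch k w + 1) ^ (2 * k) := by
  obtain ⟨h1, h2, h3⟩ := rootSearch_aux (k := k) hw w
  refine ⟨h1, h2, h3.resolve_right fun h => ?_⟩
  have := le_of_pow_two_mul_le hk h2
  omega

/-- Existence of a number with given digits. -/
theorem exists_digits {m : ℕ} (hm : 0 < m) (l : ℕ) : ∀ r : ℕ → ℕ, (∀ a < l, r a < m) →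
    ∃ z < m ^ l, ∀ a < l, z / m ^ a % m = r a := by
  induction l with
  | zero => exact fun r _ => ⟨0, by simp, by simp⟩
  | succ l ih =>
    intro r hr
    obtain ⟨z, hz, h⟩ := ih (fun a => r (a + 1)) fun a ha => hr _ (by omega)
    have h0 := hr 0 (by omega)
    refine ⟨r 0 + m * z, ?_, fun a ha => ?_⟩
    · rw [pow_succ]
      nlinarith
    · cases a with
      | zero => simp [Nat.mod_eq_of_lt h0]
      | succ a =>
        rw [pow_succ', ← Nat.div_div_eq_div_mul, Nat.add_mul_div_left _ _ hm,
          Nat.div_eq_of_lt h0, zero_add]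
        exact h a (by omega)

/-- Few multipliers of the hash functions `x ↦ i x mod p mod q` let two given keys collide. -/
theorem card_collisions_le {p q x y : ℕ} (hp : p.Prime) (hq : 1 ≤ q) (hx : x < p) (hy : y < p)
    (hxy : x ≠ y) :
    ((Finset.range p).filter fun i => i * x % p % q = i * y % p % q).card ≤ 2 * (p / q) + 1 := by
  have hp0 : (0 : ℤ) < p := by exact_mod_cast hp.pos
  have hq0 : (0 : ℤ) < q := by exact_mod_cast hq
  -- In a collision `q` divides the difference of the residues, and the quotient lies in `[-(p / q),
  -- p / q]`. It determines `i`, because the difference is `i (x - y)` modulo `p` and `x - y` is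
  -- invertible there.
  let f : ℕ → ℤ := fun i => ((i * x % p : ℕ) - (i * y % p : ℕ) : ℤ) / q
  have hf : ∀ i, i * x % p % q = i * y % p % q →
      ((i * x % p : ℕ) - (i * y % p : ℕ) : ℤ) = q * f i := by
    intro i hi
    have : (q : ℤ) ∣ ((i * x % p : ℕ) - (i * y % p : ℕ) : ℤ) :=
      (Nat.modEq_iff_dvd.1 (Eq.symm hi : i * y % p ≡ i * x % p [MOD q]))
    exact (Int.mul_ediv_cancel' this).symm
  have hcard : (Finset.Icc (-((p / q : ℕ) : ℤ)) (p / q : ℕ)).card = 2 * (p / q) + 1 := by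
    rw [Int.card_Icc]
    omega
  rw [← hcard]
  refine Finset.card_le_card_of_injOn f (fun i hi => ?_) fun i hi i' hi' h => ?_
  · have hi := (Finset.mem_filter.1 hi).2
    have h1 := hf i hi
    have h2 : ((i * x % p : ℕ) : ℤ) < p := by exact_mod_cast Nat.mod_lt _ hp.pos
    have h3 : ((i * y % p : ℕ) : ℤ) < p := by exact_mod_cast Nat.mod_lt _ hp.pos
    have h4 := Int.natCast_nonneg (i * x % p)
    have h5 := Int.natCast_nonneg (i * y % p)
    rw [Finset.mem_coe, Finset.mem_Icc, Int.natCast_div, neg_le, Int.le_ediv_iff_mul_le hq0,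
      Int.le_ediv_iff_mul_le hq0]
    constructor <;> linarith
  · have hi := Finset.mem_filter.1 hi
    have hi' := Finset.mem_filter.1 hi'
    have h1 := hf i hi.2
    have h2 := hf i' hi'.2
    rw [h, ← h2] at h1
    have h3 : ((i : ZMod p) - i') * (x - y) = 0 := by
      have := congrArg (Int.cast : ℤ → ZMod p) h1
      simp only [Int.cast_sub, Int.cast_natCast, ZMod.natCast_mod, Nat.cast_mul] at this
      linear_combination this
    have := Fact.mk hp
    have cast_inj : ∀ {a b : ℕ}, a < p → b < p → (a : ZMod p) - b = 0 → a = b := by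
      intro a b ha hb hab
      have := (ZMod.natCast_eq_natCast_iff' a b p).1 (sub_eq_zero.1 hab)
      rwa [Nat.mod_eq_of_lt ha, Nat.mod_eq_of_lt hb] at this
    rcases mul_eq_zero.1 h3 with h4 | h4
    · exact cast_inj (Finset.mem_range.1 hi.1) (Finset.mem_range.1 hi'.1) h4
    · exact absurd (cast_inj hx hy h4) hxy

/-! ### The gap-producing reduction -/

/-- A 3-CNF formula with `m` clauses, the literals being given by their numbers, together with a
division of its variables into `k` groups of size `w`. -/
structure Inst where
  k : ℕ
  w : ℕ
  m : ℕ
  lit : ℕ → ℕ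

namespace Inst

variable (I : Inst)

/-- The size of the range of the hash functions. -/
def q : ℕ := rootSearch I.k I.w

/-- The number of hash functions, and their modulus. -/
def p : ℕ := primeSearch (2 ^ I.w)

/-- The number of ways to select a clause for each `k`-tuple of hash values. -/
def choices : ℕ := I.m ^ I.q ^ I.k

/-- The number of pairs of a group and an assignment of its variables. -/
def sets : ℕ := I.k * 2 ^ I.w

/-- The number of vertices of the graph. -/
def order : ℕ := I.sets + I.p * I.choices

/-- As `p` is a prime above `2 ^ w`, distinct assignments of a group remain distinct modulo `p`. -/
def hash (i x : ℕ) : ℕ := i * x % I.p % I.q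

/-- Position `r` of the list of literals holds a literal of a variable in group `j`, made true by the
assignment `x` of this group. -/
def LitTrue (j x r : ℕ) : Prop :=
  I.lit r ≠ 0 ∧ (I.lit r - 1) / 2 / I.w = j ∧
    x / 2 ^ ((I.lit r - 1) / 2 % I.w) % 2 = I.lit r % 2

/-- The assignment `x` of group `j` satisfies clause `r`. -/
def ClauseTrue (j x r : ℕ) : Prop := ∃ t < 3, I.LitTrue j x (3 * r + t)

/-- Set vertex `u` covers the element with number `e`. -/
def Covers (u e : ℕ) : Prop :=
  ∃ a < I.q ^ I.k, a / I.q ^ (u / 2 ^ I.w) % I.q = I.hash (e / I.choices) (u % 2 ^ I.w) ∧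
    I.ClauseTrue (u / 2 ^ I.w) (u % 2 ^ I.w) (e % I.choices / I.m ^ a % I.m)

/-- Numbers below `sets` encode set vertices `j * 2 ^ w + x`. After subtraction of `sets`, an
element is `i * choices + z`, where digit `a` of `z` in base `m` is the clause selected for the
tuple with number `a`, itself written in base `q`. -/
def Adjacent (u v : ℕ) : Prop :=
  u ≠ v ∧ ((u < I.sets ∧ v < I.sets) ∨ (u < I.sets ∧ I.sets ≤ v ∧ I.Covers u (v - I.sets)) ∨
    (v < I.sets ∧ I.sets ≤ u ∧ I.Covers v (u - I.sets)))

/-- The set vertices form a clique, the elements are independent, and a set vertex is adjacent to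
the elements that it covers. -/
def graph : SimpleGraph (Fin I.order) where
  Adj u v := I.Adjacent u v
  symm := ⟨fun u v h => ⟨h.1.symm, by have := h.2; tauto⟩⟩
  loopless := ⟨fun u h => h.1 rfl⟩

/-- The assignment `β` satisfies the formula. -/
def IsModel (β : ℕ → ℕ) : Prop :=
  (∀ v, β v < 2) ∧ ∀ r < I.m, ∃ t < 3, I.lit (3 * r + t) ≠ 0 ∧
    β ((I.lit (3 * r + t) - 1) / 2) = I.lit (3 * r + t) % 2

/-! ### Completeness and soundness of the reduction -/

variable {I}

theorem q_pos (hk : 1 ≤ I.k) (hw : 1 ≤ I.w) : 1 ≤ I.q := (rootSearch_spec hk hw).1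

/-- One vertex per group, given by the bits of `β` on that group. The clique takes care of the set
vertices; for an element, the tuple of hash values selects a clause, and the group of a true literal
in this clause covers the element. -/
theorem exists_isDominating {β : ℕ → ℕ} (hβ : I.IsModel β) (hk : 1 ≤ I.k) (hw : 1 ≤ I.w)
    (hlit : ∀ r, I.lit r ≠ 0 → (I.lit r - 1) / 2 < I.k * I.w) :
    ∃ S : Finset (Fin I.order), IsDominating I.graph S ∧ S.card ≤ I.k := by
  classical
  have hq := q_pos hk hw
  choose x hx hbit using fun j => exists_digits two_pos I.w (fun t => β (j * I.w + t))
    fun t _ => hβ.1 _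
  have hu : ∀ j < I.k, j * 2 ^ I.w + x j < I.sets := by
    intro j hj
    have := Nat.mul_le_mul_right (2 ^ I.w) (Nat.succ_le_of_lt hj)
    have := hx j
    unfold sets
    lia
  have hle : I.sets ≤ I.order := Nat.le_add_right _ _
  have hdiv : ∀ j, (j * 2 ^ I.w + x j) / 2 ^ I.w = j := fun j => by
    rw [mul_comm, Nat.mul_add_div (by positivity), Nat.div_eq_of_lt (hx j), add_zero]
  have hmod : ∀ j, (j * 2 ^ I.w + x j) % 2 ^ I.w = x j := fun j => by
    rw [mul_comm, Nat.mul_add_mod, Nat.mod_eq_of_lt (hx j)]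
  let vert : Fin I.k → Fin I.order := fun j => ⟨j * 2 ^ I.w + x j, (hu j j.2).trans_le hle⟩
  refine ⟨Finset.univ.image vert, fun v hv => ?_, Finset.card_image_le.trans (by simp)⟩
  rcases lt_or_ge v.val I.sets with h | h
  · have hmem : vert ⟨0, hk⟩ ∈ Finset.univ.image vert := Finset.mem_image_of_mem _ (Finset.mem_univ _)
    refine ⟨_, hmem, fun h' => hv ?_, Or.inl ⟨hu 0 hk, h⟩⟩
    rwa [← Fin.ext h']
  · have he : v.val - I.sets < I.p * I.choices := by
      have := v.2
      unfold order at this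
      omega
    -- That an element exists at all forces `choices`, and hence `m`, to be positive.
    set e := v.val - I.sets
    have hc : 0 < I.choices := Nat.pos_of_ne_zero fun h0 => by simp [h0] at he
    have hm : 0 < I.m := Nat.pos_of_ne_zero fun h0 => by
      rw [choices, h0, zero_pow (pow_pos hq _).ne'] at hc
      exact lt_irrefl _ hc
    obtain ⟨a, ha, had⟩ := exists_digits hq I.k (fun j => I.hash (e / I.choices) (x j))
      fun j _ => Nat.mod_lt _ hq
    obtain ⟨t, ht, h0, hv1⟩ := hβ.2 _ (Nat.mod_lt (e % I.choices / I.m ^ a) hm)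
    set r := 3 * (e % I.choices / I.m ^ a % I.m) + t
    have hj : (I.lit r - 1) / 2 / I.w < I.k :=
      Nat.div_lt_of_lt_mul (by rw [mul_comm]; exact hlit r h0)
    refine ⟨vert ⟨_, hj⟩, Finset.mem_image_of_mem _ (Finset.mem_univ _), ?_,
      Or.inr (Or.inl ⟨hu _ hj, h, a, ha, ?_, t, ht, h0, ?_, ?_⟩)⟩
    · exact ((hu _ hj).trans_le h).ne
    · simp only [vert, hdiv, hmod]
      exact had _ hj
    · simp only [vert, hdiv]
      rfl
    · simp only [vert, hmod]
      rw [hbit _ _ (Nat.mod_lt _ hw), mul_comm, Nat.div_add_mod]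
      exact hv1

/-- The hash function separates the assignments of each group that occur in `D`. -/
def Separates (I : Inst) (D : Finset ℕ) (i : ℕ) : Prop :=
  ∀ u ∈ D, ∀ v ∈ D, u / 2 ^ I.w = v / 2 ^ I.w →
    I.hash i (u % 2 ^ I.w) = I.hash i (v % 2 ^ I.w) → u = v

/-- A union bound over ordered pairs: two different vertices of one group carry different
assignments, so a failure of separation is a collision of distinct keys. -/
theorem card_not_separates_le (hk : 1 ≤ I.k) (hw : 1 ≤ I.w) (D : Finset ℕ)
    [DecidablePred (I.Separates D)] :
    ((Finset.range I.p).filter fun i => ¬ I.Separates D i).card ≤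
      D.card ^ 2 * (2 * (I.p / I.q) + 1) := by
  obtain ⟨hp, hp1, -⟩ := primeSearch_spec (N := 2 ^ I.w) Nat.one_le_two_pow
  change I.p.Prime at hp
  change _ < I.p at hp1
  have hlt : ∀ u, u % 2 ^ I.w < I.p := fun u => (Nat.mod_lt _ (by positivity)).trans hp1
  let pairs := (D ×ˢ D).filter fun c => c.1 % 2 ^ I.w ≠ c.2 % 2 ^ I.w
  have hsub : ((Finset.range I.p).filter fun i => ¬ I.Separates D i) ⊆ pairs.biUnion fun c =>
      (Finset.range I.p).filter fun i =>
        i * (c.1 % 2 ^ I.w) % I.p % I.q = i * (c.2 % 2 ^ I.w) % I.p % I.q := by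
    intro i hi
    obtain ⟨hi, hs⟩ := Finset.mem_filter.1 hi
    unfold Separates at hs
    push Not at hs
    obtain ⟨u, hu, v, hv, h1, h2, h3⟩ := hs
    refine Finset.mem_biUnion.2 ⟨(u, v), Finset.mem_filter.2
      ⟨Finset.mem_product.2 ⟨hu, hv⟩, fun h4 => h3 ?_⟩, Finset.mem_filter.2 ⟨hi, h2⟩⟩
    rw [← Nat.div_add_mod u (2 ^ I.w), h1, h4, Nat.div_add_mod]
  refine (Finset.card_le_card hsub).trans ((Finset.card_biUnion_le_card_mul _ _ _ fun c hc =>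
    card_collisions_le hp (q_pos hk hw) (hlt _) (hlt _) (Finset.mem_filter.1 hc).2).trans
      (Nat.mul_le_mul_right _ ?_))
  exact (Finset.card_filter_le _ _).trans_eq (by rw [Finset.card_product, sq])

/-- If a separating hash function and a tuple of hash values leave no clause unsatisfied, then the
formula is satisfiable. -/
theorem exists_isModel_of_separates {D : Finset ℕ} {i a : ℕ} (hs : I.Separates D i)
    (h : ∀ r < I.m, ∃ u ∈ D, a / I.q ^ (u / 2 ^ I.w) % I.q = I.hash i (u % 2 ^ I.w) ∧
      I.ClauseTrue (u / 2 ^ I.w) (u % 2 ^ I.w) r) : ∃ β, I.IsModel β := by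
  classical
  -- Separation leaves at most one selected vertex per group, so the selected assignments glue
  -- together. Groups without one receive `0`, which is harmless: each clause is satisfied by a
  -- selected vertex.
  let sel : ℕ → ℕ → Prop := fun j u => u ∈ D ∧ u / 2 ^ I.w = j ∧
    a / I.q ^ (u / 2 ^ I.w) % I.q = I.hash i (u % 2 ^ I.w)
  have huniq : ∀ j u v, sel j u → sel j v → u = v := fun j u v hu hv =>
    hs u hu.1 v hv.1 (hu.2.1.trans hv.2.1.symm) (by rw [← hu.2.2, ← hv.2.2, hu.2.1, hv.2.1])
  let x : ℕ → ℕ := fun j => if h : ∃ u, sel j u then h.choose % 2 ^ I.w else 0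
  have hx : ∀ j u, sel j u → x j = u % 2 ^ I.w := by
    intro j u hu
    have he : ∃ u, sel j u := ⟨u, hu⟩
    simp only [x, dif_pos he]
    rw [huniq j _ _ he.choose_spec hu]
  refine ⟨fun v => x (v / I.w) / 2 ^ (v % I.w) % 2, fun v => Nat.mod_lt _ two_pos, fun r hr => ?_⟩
  obtain ⟨u, hu, hh, t, ht, h0, hj, hb⟩ := h r hr
  refine ⟨t, ht, h0, ?_⟩
  change x _ / _ % 2 = _
  rw [hj, hx _ u ⟨hu, rfl, hh⟩, hb]

/-- Without a model, every separating hash function `i` has an element `(i, z i)` that no set vertex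
of `D` covers, where `z i` lists a missed clause for each tuple. -/
theorem exists_isModel_of_dominating (hk : 1 ≤ I.k) (hw : 1 ≤ I.w) {D : Finset ℕ}
    (hD : 4 * D.card ^ 2 < I.q) (hdom : ∀ v < I.order, v ∈ D ∨ ∃ u ∈ D, I.Adjacent u v) :
    ∃ β, I.IsModel β := by
  classical
  by_contra hno
  have hq := q_pos hk hw
  have hun : ∀ i, I.Separates D i → ∃ z < I.choices, ∀ a < I.q ^ I.k,
      ∀ u ∈ D, a / I.q ^ (u / 2 ^ I.w) % I.q = I.hash i (u % 2 ^ I.w) →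
        ¬ I.ClauseTrue (u / 2 ^ I.w) (u % 2 ^ I.w) (z / I.m ^ a % I.m) := by
    intro i hi
    have hr : ∀ a, ∃ r < I.m, ∀ u ∈ D, a / I.q ^ (u / 2 ^ I.w) % I.q = I.hash i (u % 2 ^ I.w) →
        ¬ I.ClauseTrue (u / 2 ^ I.w) (u % 2 ^ I.w) r := by
      intro a
      by_contra hc
      push Not at hc
      exact hno (exists_isModel_of_separates hi hc)
    choose r hr1 hr2 using hr
    obtain ⟨z, hz, hd⟩ := exists_digits ((Nat.zero_le _).trans_lt (hr1 0)) (I.q ^ I.k) r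
      fun a _ => hr1 a
    exact ⟨z, hz, fun a ha u hu hh => by rw [hd a ha]; exact hr2 a u hu hh⟩
  choose! z hz hzu using hun
  -- Elements are pairwise non-adjacent, so the uncovered element of a separating function must
  -- itself belong to `D`.
  have hgood : ((Finset.range I.p).filter (I.Separates D)).card ≤ D.card := by
    have hdm : ∀ i, I.Separates D i → (i * I.choices + z i) / I.choices = i ∧
        (i * I.choices + z i) % I.choices = z i := by
      intro i hi
      have := hz i hi
      constructor
      · rw [mul_comm, Nat.mul_add_div (by omega), Nat.div_eq_of_lt this, add_zero]
      · rw [mul_comm, Nat.mul_add_mod, Nat.mod_eq_of_lt this]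
    refine Finset.card_le_card_of_injOn (fun i => I.sets + (i * I.choices + z i))
      (fun i hi => ?_) fun i hi i' hi' h => ?_
    · obtain ⟨hip, hi⟩ := Finset.mem_filter.1 hi
      have hip := Finset.mem_range.1 hip
      have hlt : I.sets + (i * I.choices + z i) < I.order := by
        have := Nat.mul_le_mul_right I.choices (Nat.succ_le_of_lt hip)
        have := hz i hi
        unfold order
        lia
      refine (hdom _ hlt).resolve_right ?_
      rintro ⟨u, hu, -, ⟨-, h⟩ | ⟨-, -, h⟩ | ⟨h, -⟩⟩
      · omega
      · obtain ⟨a, ha, hh, hc⟩ := h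
        rw [Nat.add_sub_cancel_left, (hdm i hi).1] at hh
        rw [Nat.add_sub_cancel_left, (hdm i hi).2] at hc
        exact hzu i hi a ha u hu hh hc
      · omega
    · have hi := (Finset.mem_filter.1 hi).2
      have hi' := (Finset.mem_filter.1 hi').2
      rw [← (hdm i hi).1, ← (hdm i' hi').1, Nat.add_left_cancel h]
  have hbad := card_not_separates_le hk hw D
  have hsum := Finset.card_filter_add_card_filter_not (s := Finset.range I.p) (I.Separates D)
  rw [Finset.card_range] at hsum
  have hqp : I.q < I.p :=
    (le_of_pow_two_mul_le hk (rootSearch_spec hk hw).2.1).trans_lt (Nat.lt_two_pow_self.trans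
      (primeSearch_spec (N := 2 ^ I.w) Nat.one_le_two_pow).2.1)
  have hdiv := Nat.mul_div_le I.p I.q
  have hsq : D.card ≤ D.card ^ 2 := Nat.le_self_pow two_ne_zero _
  have hmul : (4 * D.card ^ 2 + 1) * (I.p / I.q) ≤ I.q * (I.p / I.q) :=
    Nat.mul_le_mul_right _ hD
  -- Counting all `p` functions gives `p ≤ 2 |D|² + 2 |D|² (p / q)`. Here `4 |D|² < q < p`, and `4
  -- |D|² (p / q) ≤ p` by `hmul` and `hdiv`, so the right side is below `p`.
  nlinarith

end Inst
/-! ### The reduction is computable in polynomial time -/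

namespace Feasible

variable {X : Ctx Γ} {f : Γ → ℕ}

theorem read {F : Γ → ℕ → ℕ} (a : ℕ) (hf : Feasible X f) (hb : X.PolyBdd (fun γ => F γ (f γ)))
    (h : ∀ γ A, X.mem γ A → A a = F γ) : Feasible X (fun γ => F γ (f γ)) :=
  hf.comp_expr hb (fun x => .read a (.var x)) 2 (fun _ => le_rfl)
    fun _ γ s x hs hx => by simp [Expr.eval, h γ _ hs.2, hx]

theorem read_ne_zero {F : Γ → ℕ → ℕ} (a : ℕ) (hf : Feasible X f)
    (h : ∀ γ A, X.mem γ A → A a = F γ) : FeasiblePred X (fun γ => F γ (f γ) ≠ 0) := by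
  classical
  refine hf.comp_expr ((Ctx.PolyBdd.const 1).mono fun γ _ _ => by split_ifs <;> simp)
    (fun x => .sub (.const 1) (.sub (.const 1) (.read a (.var x)))) 6 (fun _ => le_rfl)
    fun _ γ s x hs hx => ?_
  simp only [Expr.eval, h γ _ hs.2, hx]
  split_ifs <;> omega

theorem prime (hf : Feasible X f) : FeasiblePred X (fun γ => (f γ).Prime) :=
  (((const 2).le hf).and (FeasiblePred.ball (p := fun γ m => m < 2 ∨ ¬ f γ % m = 0) hf
    (((snd hf.1).lt (const 2)).or ((hf.comp_fst.mod (snd hf.1)).eq (const 0)).not))).congr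
      fun γ _ _ => by
        simp only [Nat.prime_def_lt', Nat.dvd_iff_mod_eq_zero]
        refine and_congr Iff.rfl ⟨fun h m hm => ?_, fun h m h2 hm => ?_⟩
        · exact (lt_or_ge m 2).imp id fun h2 => h m h2 hm
        · exact (h m hm).resolve_left (by omega)

end Feasible

/-- The parameters are large enough for the reduction to take time polynomial in `2 ^ w`. -/
structure Inst.Valid (I : Inst) : Prop where
  one_le_k : 1 ≤ I.k
  one_le_w : 1 ≤ I.w
  k_le : I.k ≤ 2 ^ I.w
  m_le : I.m ≤ 2 ^ I.w
  pow_le : (I.w + 2) ^ (2 * I.k) ≤ 2 ^ I.w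
  choices_le : I.choices ≤ 2 ^ I.w
  lit_le : ∀ r, I.lit r ≤ 2 ^ I.w

theorem Inst.q_pow_le {I : Inst} (hk : 1 ≤ I.k) (hw : 1 ≤ I.w) : I.q ^ I.k ≤ I.w :=
  (Nat.pow_le_pow_right (q_pos hk hw) (by omega)).trans (rootSearch_spec hk hw).2.1

/-- In the context `X`, the memory describes an instance. -/
structure Describes (X : Ctx Γ) (I : Γ → Inst) : Prop where
  k : Feasible X (fun γ => (I γ).k)
  w : Feasible X (fun γ => (I γ).w)
  m : Feasible X (fun γ => (I γ).m)
  arr : ∀ γ A, X.mem γ A → A 0 = (I γ).lit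
  valid : ∀ γ A, X.mem γ A → (I γ).Valid
  size : ∀ γ, X.size γ = 2 ^ (I γ).w

/-! ### Feasibility of the ingredients of the graph -/

namespace Describes

variable {X : Ctx Γ} {I : Γ → Inst} {f g h : Γ → ℕ}

theorem push (hX : Describes X I) (b : Γ → ℕ) : Describes (X.push b) (fun p => I p.1) where
  k := hX.k.comp_fst
  w := hX.w.comp_fst
  m := hX.m.comp_fst
  arr p A hA := hX.arr p.1 A hA.1
  valid p A hA := hX.valid p.1 A hA.1
  size p := hX.size p.1

theorem polyBdd (hX : Describes X I)
    (h : ∀ γ A, X.mem γ A → (I γ).Valid → f γ ≤ 2 ^ (I γ).w) : X.PolyBdd f :=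
  Ctx.PolyBdd.size.mono fun γ A hA => (h γ A hA (hX.valid γ A hA)).trans_eq (hX.size γ).symm

theorem two_pow_w (hX : Describes X I) : Feasible X (fun γ => 2 ^ (I γ).w) :=
  (Feasible.const 2).pow hX.w (hX.polyBdd fun _ _ _ _ => le_rfl)

theorem lit (hX : Describes X I) (hf : Feasible X f) : Feasible X (fun γ => (I γ).lit (f γ)) :=
  hf.read 0 (hX.polyBdd fun _ _ _ hv => hv.lit_le _) hX.arr

theorem p (hX : Describes X I) : Feasible X (fun γ => (I γ).p) := by
  have hB : X.PolyBdd (fun γ => 2 * 2 ^ (I γ).w + 1) :=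
    (((Feasible.const 2).mul hX.two_pow_w).add (.const 1)).1
  have hs := Feasible.snd (X := X.push fun γ => 2 ^ (I γ).w) hB.comp_fst
  exact Feasible.natRec (F := fun _ _ a => if a.Prime then a else a + 1) hX.two_pow_w
    (hX.two_pow_w.add (.const 1)) (Feasible.ite hs.prime hs (hs.add (.const 1))) hB
    fun γ A hA j _ => Nat.lt_succ_of_le (primeSearch_iterate_le Nat.one_le_two_pow j)

theorem q (hX : Describes X I) : Feasible X (fun γ => (I γ).q) := by
  have hB : X.PolyBdd (fun γ => (I γ).w + 1) := (hX.w.add (.const 1)).1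
  have hs := Feasible.snd (X := X.push fun γ => (I γ).w) hB.comp_fst
  have hX' := (hX.push fun γ => (I γ).w).push fun p => (I p.1).w + 1
  -- The search also tries a power that exceeds `w`; the field `pow_le` of `Inst.Valid` keeps it
  -- polynomial in `2 ^ w`.
  have hpow := (hs.add (.const 1)).pow ((Feasible.const 2).mul hX'.k) (hX'.polyBdd
    fun p A hA hv => (Nat.pow_le_pow_left (Nat.le_succ_of_le hA.2) _).trans hv.pow_le)
  refine Feasible.natRec (F := fun γ _ a => if (a + 1) ^ (2 * (I γ).k) ≤ (I γ).w then a + 1 else a)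
    hX.w (.const 1) (Feasible.ite (hpow.le hX'.w) (hs.add (.const 1)) hs) hB fun γ A hA j _ => ?_
  have hv := hX.valid γ A hA
  exact Nat.lt_succ_of_le (le_of_pow_two_mul_le hv.one_le_k (rootSearch_aux hv.one_le_w j).2.1)

theorem q_pow (hX : Describes X I) (hf : Feasible X f)
    (h : ∀ γ A, X.mem γ A → f γ ≤ (I γ).k) : Feasible X (fun γ => (I γ).q ^ f γ) :=
  hX.q.pow hf (hX.polyBdd fun γ A hA hv =>
    (Nat.pow_le_pow_right (Inst.q_pos hv.one_le_k hv.one_le_w) (h γ A hA)).trans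
      ((Inst.q_pow_le hv.one_le_k hv.one_le_w).trans Nat.lt_two_pow_self.le))

theorem choices (hX : Describes X I) : Feasible X (fun γ => (I γ).choices) :=
  hX.m.pow (hX.q_pow hX.k fun _ _ _ => le_rfl) (hX.polyBdd fun _ _ _ hv => hv.choices_le)

theorem sets (hX : Describes X I) : Feasible X (fun γ => (I γ).sets) := hX.k.mul hX.two_pow_w

theorem order (hX : Describes X I) : Feasible X (fun γ => (I γ).order) :=
  hX.sets.add (hX.p.mul hX.choices)

theorem hash (hX : Describes X I) (hf : Feasible X f) (hg : Feasible X g) :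
    Feasible X (fun γ => (I γ).hash (f γ) (g γ)) :=
  ((hf.mul hg).mod hX.p).mod hX.q

theorem litTrue (hX : Describes X I) (hf : Feasible X f) (hg : Feasible X g)
    (hh : Feasible X h) : FeasiblePred X (fun γ => (I γ).LitTrue (f γ) (g γ) (h γ)) := by
  have hl := hX.lit hh
  have hv := (hl.sub (.const 1)).div (.const 2)
  refine (hl.eq (.const 0)).not.and (((hv.div hX.w).eq hf).and
    (Feasible.eq ((hg.div ((Feasible.const 2).pow (hv.mod hX.w) ?_)).mod (.const 2))
      (hl.mod (.const 2))))
  exact hX.polyBdd fun γ A hA hv =>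
    Nat.pow_le_pow_right two_pos (Nat.mod_lt _ hv.one_le_w).le

theorem clauseTrue (hX : Describes X I) (hf : Feasible X f) (hg : Feasible X g)
    (hh : Feasible X h) : FeasiblePred X (fun γ => (I γ).ClauseTrue (f γ) (g γ) (h γ)) :=
  FeasiblePred.bex (p := fun γ t => (I γ).LitTrue (f γ) (g γ) (3 * h γ + t)) (.const 3)
    ((hX.push _).litTrue hf.comp_fst hg.comp_fst
      (((Feasible.const 3).mul hh.comp_fst).add (.snd (.const 3))))

/-- For a set vertex the group number is below `k`, which keeps the power of `q` in the definition
polynomially bounded. -/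
theorem covers (hX : Describes X I) (hf : Feasible X f) (hg : Feasible X g)
    (hlt : ∀ γ A, X.mem γ A → f γ < (I γ).sets) :
    FeasiblePred X (fun γ => (I γ).Covers (f γ) (g γ)) := by
  have hb := hX.q_pow hX.k fun _ _ _ => le_rfl
  have hX' := hX.push fun γ => (I γ).q ^ (I γ).k
  have hj : Feasible X (fun γ => f γ / 2 ^ (I γ).w) := hf.div hX.two_pow_w
  have hx : Feasible X (fun γ => f γ % 2 ^ (I γ).w) := hf.mod hX.two_pow_w
  have hi : Feasible X (fun γ => g γ / (I γ).choices) := hg.div hX.choices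
  have hz : Feasible X (fun γ => g γ % (I γ).choices) := hg.mod hX.choices
  have ha := Feasible.snd (X := X) hb.1
  have hq := hX.q_pow hj fun γ A hA =>
    (Nat.div_lt_of_lt_mul ((hlt γ A hA).trans_eq (mul_comm _ _))).le
  refine FeasiblePred.bex hb ((Feasible.eq ((ha.div hq.comp_fst).mod hX'.q)
    (hX'.hash hi.comp_fst hx.comp_fst)).and (hX'.clauseTrue hj.comp_fst hx.comp_fst
      ((hz.comp_fst.div (hX'.m.pow ha (hX'.polyBdd fun p A hA hv => ?_))).mod hX'.m)))
  rcases Nat.eq_zero_or_pos (I p.1).m with h0 | h0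
  · rw [h0]
    exact ((Nat.pow_le_pow_left zero_le_one _).trans_eq (one_pow _)).trans Nat.one_le_two_pow
  · exact (Nat.pow_le_pow_right h0 hA.2.le).trans hv.choices_le

theorem adjacent (hX : Describes X I) (hf : Feasible X f) (hg : Feasible X g) :
    FeasiblePred X (fun γ => (I γ).Adjacent (f γ) (g γ)) := by
  have hpos : ∀ γ A, X.mem γ A → 0 < (I γ).sets := fun γ A hA =>
    Nat.mul_pos (hX.valid γ A hA).one_le_k (by positivity)
  have hcov : ∀ {f g : Γ → ℕ}, Feasible X f → Feasible X g →
      FeasiblePred X (fun γ => f γ < (I γ).sets ∧ (I γ).sets ≤ g γ ∧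
        (I γ).Covers (f γ) (g γ - (I γ).sets)) := by
    intro f g hf hg
    -- A conjunction evaluates all its parts, so `covers` needs an argument that is always below
    -- `sets`; reduction modulo `sets` changes nothing where it matters.
    refine ((hf.lt hX.sets).and ((hX.sets.le hg).and (hX.covers (hf.mod hX.sets)
      (hg.sub hX.sets) fun γ A hA => Nat.mod_lt _ (hpos γ A hA)))).congr fun γ A hA => ?_
    refine and_congr_right fun h => ?_
    rw [Nat.mod_eq_of_lt h]
  exact (hf.eq hg).not.and (((hf.lt hX.sets).and (hg.lt hX.sets)).or ((hcov hf hg).or (hcov hg hf)))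

end Describes

/-- The set with characteristic function `o` is dominating, and small enough to witness that the
formula is satisfiable. -/
def Inst.Accepts (I : Inst) (o : ℕ → ℕ) : Prop :=
  4 * ((Finset.range I.order).filter fun v => o v ≠ 0).card ^ 2 < I.q ∧
    ∀ v < I.order, o v ≠ 0 ∨ ∃ u < I.order, o u ≠ 0 ∧ I.Adjacent u v

theorem Describes.accepts {X : Ctx Γ} {I : Γ → Inst} {o : Γ → ℕ → ℕ} (hX : Describes X I) (a : ℕ)
    (ho : ∀ γ A, X.mem γ A → A a = o γ) : FeasiblePred X (fun γ => (I γ).Accepts (o γ)) := by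
  have hX' := hX.push fun γ => (I γ).order
  have hv := Feasible.snd (X := X) hX.order.1
  have hu := Feasible.snd (X := X.push fun γ => (I γ).order) hX'.order.1
  have ho' := hv.read_ne_zero (F := fun p => o p.1) a fun p A hA => ho p.1 A hA.1
  have hc := Feasible.count (p := fun γ v => o γ v ≠ 0) hX.order ho'
  refine FeasiblePred.congr (((Feasible.const 4).mul (hc.mul hc)).lt hX.q |>.and
    (FeasiblePred.ball (p := fun γ v => o γ v ≠ 0 ∨ ∃ u < (I γ).order, o γ u ≠ 0 ∧
      (I γ).Adjacent u v) hX.order (ho'.or (FeasiblePred.bex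
        (p := fun p u => o p.1 u ≠ 0 ∧ (I p.1).Adjacent u p.2) hX'.order ((hu.read_ne_zero
          (F := fun p => o p.1.1) a fun p A hA => ho p.1.1 A hA.1.1).and
            ((hX'.push fun p => (I p.1).order).adjacent hu hv.comp_fst)))))) fun γ A _ => ?_
  rw [Inst.Accepts, sq]

theorem Inst.exists_isModel_of_accepts {I : Inst} (hk : 1 ≤ I.k) (hw : 1 ≤ I.w) {o : ℕ → ℕ}
    (h : I.Accepts o) : ∃ β, I.IsModel β := by
  refine exists_isModel_of_dominating hk hw h.1 fun v hv => ?_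
  simp only [Finset.mem_filter, Finset.mem_range]
  refine (h.2 v hv).imp (fun h => ⟨hv, h⟩) ?_
  rintro ⟨u, hu, h1, h2⟩
  exact ⟨u, ⟨hu, h1⟩, h2⟩

/-- The memory holds `k`, `w` and `m` in the variables, and the literals in array `0`. -/
def instCtx : Ctx Inst where
  depth := 3
  val I i := if i = 0 then I.k else if i = 1 then I.w else I.m
  mem I A := A 0 = I.lit ∧ I.Valid
  size I := 2 ^ I.w

/-- The same, with a further sequence held in array `2`. -/
def outCtx : Ctx (Inst × (ℕ → ℕ)) where
  depth := 3
  val c i := instCtx.val c.1 i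
  mem c A := instCtx.mem c.1 A ∧ A 2 = c.2
  size c := 2 ^ c.1.w

theorem describes_outCtx : Describes outCtx Prod.fst := by
  have hb : ∀ f : Inst → ℕ, (∀ I, I.Valid → f I ≤ 2 ^ I.w) → outCtx.PolyBdd (fun c => f c.1) :=
    fun f h => Ctx.PolyBdd.size.mono fun c A hA => h c.1 hA.1.2
  refine ⟨.var 0 (by simp [outCtx]) (hb (·.k) fun I h => h.k_le) ?_,
    .var 1 (by simp [outCtx]) (hb (·.w) fun I _ => Nat.lt_two_pow_self.le) ?_,
    .var 2 (by simp [outCtx]) (hb (·.m) fun I h => h.m_le) ?_,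
    fun c A hA => hA.1.1, fun c A hA => hA.1.2, fun c => rfl⟩ <;> simp [outCtx, instCtx]

theorem describes_instCtx : Describes instCtx id := by
  have hb : ∀ f : Inst → ℕ, (∀ I, I.Valid → f I ≤ 2 ^ I.w) → instCtx.PolyBdd f :=
    fun f h => Ctx.PolyBdd.size.mono fun c A hA => h c hA.2
  refine ⟨.var 0 (by simp [instCtx]) (hb (·.k) fun I h => h.k_le) ?_,
    .var 1 (by simp [instCtx]) (hb (·.w) fun I _ => Nat.lt_two_pow_self.le) ?_,
    .var 2 (by simp [instCtx]) (hb (·.m) fun I h => h.m_le) ?_,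
    fun c A hA => hA.1, fun c A hA => hA.2, fun c => rfl⟩ <;> simp [instCtx]

/-! ### Formulae as instances -/

namespace CNF3

variable {n : ℕ} (φ : CNF3 n)

/-- The instance with `k` groups of `w` variables for a formula. -/
def toInst (k w : ℕ) : Inst where
  k := k
  w := w
  m := φ.clauses.length
  lit := φ.input.arr 0

theorem input_lit {r t : ℕ} (hr : r < φ.clauses.length) (ht : t < 3) :
    φ.input.arr 0 (3 * r + t) = match (φ.clauses[r])[t]? with
      | some l => litCode l
      | none => 0 := by
  have h1 : (3 * r + t) / 3 = r := by omega
  have h2 : (3 * r + t) % 3 = t := by omega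
  rcases h : (φ.clauses[r])[t]? with _ | l <;> simp [input, h1, h2, hr, h]

theorem input_lit_cases (i : ℕ) :
    φ.input.arr 0 i = 0 ∨ ∃ l : Literal n, φ.input.arr 0 i = litCode l := by
  simp only [input, if_true]
  split
  · split
    · exact Or.inr ⟨_, rfl⟩
    · exact Or.inl rfl
  · exact Or.inl rfl

theorem litCode_var (l : Literal n) : (litCode l - 1) / 2 = l.1 := by
  unfold litCode
  split_ifs <;> omega

theorem litCode_mod (l : Literal n) : litCode l % 2 = if l.2 then 1 else 0 := by
  unfold litCode
  split_ifs <;> omega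

theorem litCode_ne_zero (l : Literal n) : litCode l ≠ 0 := by
  unfold litCode
  split_ifs <;> omega

theorem input_lit_le (i : ℕ) : φ.input.arr 0 i ≤ 2 * n := by
  rcases φ.input_lit_cases i with h | ⟨l, h⟩
  · omega
  · have := l.1.2
    rw [h, litCode]
    split_ifs <;> omega

theorem input_lit_var_lt {i : ℕ} (hi : φ.input.arr 0 i ≠ 0) : (φ.input.arr 0 i - 1) / 2 < n := by
  rcases φ.input_lit_cases i with h | ⟨l, h⟩
  · exact absurd h hi
  · rw [h, litCode_var]
    exact l.1.2

/-- A literal code `c` stores the variable as `(c - 1) / 2` and the satisfying value as its parity;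
models do not depend on the grouping. -/
theorem satisfiable_iff (k w : ℕ) : φ.Satisfiable ↔ ∃ β, (φ.toInst k w).IsModel β := by
  constructor
  · rintro ⟨α, hα⟩
    refine ⟨fun v => if h : v < n then (if α ⟨v, h⟩ then 1 else 0) else 0, fun v => ?_,
      fun r hr => ?_⟩
    · dsimp only
      split_ifs <;> omega
    · change r < φ.clauses.length at hr
      obtain ⟨l, hl, hv⟩ := hα _ (List.getElem_mem hr)
      obtain ⟨t, ht, htl⟩ := List.mem_iff_getElem.1 hl
      have ht3 : t < 3 := ht.trans_le (φ.width _ (List.getElem_mem hr))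
      have hlit : (φ.toInst k w).lit (3 * r + t) = litCode l := by
        refine (φ.input_lit hr ht3).trans ?_
        rw [List.getElem?_eq_getElem ht, htl]
      refine ⟨t, ht3, ?_, ?_⟩
      · rw [hlit]
        exact litCode_ne_zero l
      · rw [hlit, litCode_var, litCode_mod, ← hv]
        exact dif_pos l.1.2
  · rintro ⟨β, -, hβ⟩
    refine ⟨fun v => decide (β v = 1), fun C hC => ?_⟩
    obtain ⟨r, hr, rfl⟩ := List.mem_iff_getElem.1 hC
    obtain ⟨t, ht, h0, hb⟩ := hβ r hr
    have hlit : (φ.toInst k w).lit (3 * r + t) = _ := φ.input_lit hr ht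
    rcases h : (φ.clauses[r])[t]? with _ | l
    · rw [h] at hlit
      exact absurd hlit h0
    · rw [h] at hlit
      refine ⟨l, List.mem_of_getElem? h, ?_⟩
      rw [hlit, litCode_var, litCode_mod] at hb
      change decide (β l.1 = 1) = l.2
      rw [hb]
      cases l.2 <;> simp

/-- Each nonempty clause is charged to a variable in it; the extra `1` is the empty clause, which
occurs at most once as clauses are distinct. -/
theorem length_clauses_le (h : φ.AtMostThreeOccurrences) : φ.clauses.length ≤ 3 * n + 1 := by
  classical
  have hsub : φ.clauses.toFinset ⊆ insert [] (Finset.univ.biUnion fun v : Fin n =>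
      (φ.clauses.filter fun C => v ∈ C.map Prod.fst).toFinset) := by
    intro C hC
    rcases C with _ | ⟨l, C⟩
    · exact Finset.mem_insert_self _ _
    · refine Finset.mem_insert_of_mem (Finset.mem_biUnion.2 ⟨l.1, Finset.mem_univ _, ?_⟩)
      rw [List.mem_toFinset, List.mem_filter]
      exact ⟨List.mem_toFinset.1 hC, by simp⟩
  have hcard := Finset.card_le_card hsub
  rw [List.toFinset_card_of_nodup φ.nodup] at hcard
  refine hcard.trans ((Finset.card_insert_le _ _).trans (Nat.add_le_add_right ?_ 1))
  refine (Finset.card_biUnion_le_card_mul _ _ 3 fun v _ =>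
    (List.toFinset_card_le _).trans (h v)).trans_eq ?_
  rw [Finset.card_univ, Fintype.card_fin, mul_comm]

end CNF3

/-! ### Large parameters -/

theorem exists_pow_le_two_pow (c d : ℕ) : ∃ n₀, ∀ n, n₀ ≤ n → (n + c) ^ d ≤ 2 ^ n := by
  have h := tendsto_pow_const_div_const_pow_of_one_lt d (one_lt_two (α := ℝ))
  obtain ⟨n₀, h⟩ := eventually_atTop.1
    (h.eventually (ge_mem_nhds (show (0 : ℝ) < 1 / 2 ^ c by positivity)))
  refine ⟨n₀, fun n hn => ?_⟩
  have h := h (n + c) (by omega)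
  rw [div_le_div_iff₀ (by positivity) (by positivity), one_mul, pow_add] at h
  have h := le_of_mul_le_mul_right h (by positivity)
  exact_mod_cast h

/-- The conditions serve, in turn, to bound the number of groups, the number of clauses and the
literal codes, the powers tried in the root search, and to secure the gap in `four_mul_sq_lt`. -/
theorem exists_large (k : ℕ) : ∃ w₀, 1 ≤ w₀ ∧ ∀ w, w₀ ≤ w →
    k + 1 ≤ 2 ^ w ∧ 4 * k * w + 1 ≤ 2 ^ Nat.sqrt w ∧ (w + 2) ^ (2 * k) ≤ 2 ^ w ∧
      4 * 5 ^ (4 * k) * k ^ (8 * k + 1) < w := by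
  obtain ⟨a, ha⟩ := exists_pow_le_two_pow 2 (2 * k)
  obtain ⟨b, hb⟩ := exists_pow_le_two_pow 1 3
  refine ⟨k + a + (b + 4 * k + 1) * (b + 4 * k + 1) + 4 * 5 ^ (4 * k) * k ^ (8 * k + 1) + 1,
    by omega, fun w hw => ⟨?_, ?_, ha w (by omega), by omega⟩⟩
  · have := Nat.lt_two_pow_self (n := w)
    omega
  · have hs : b + 4 * k + 1 ≤ Nat.sqrt w := Nat.le_sqrt.2 (by omega)
    have h1 := hb (Nat.sqrt w) (by omega)
    have h2 : w < (Nat.sqrt w + 1) * (Nat.sqrt w + 1) := Nat.sqrt_lt.1 (Nat.lt_succ_self _)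
    refine le_trans ?_ h1
    set s := Nat.sqrt w
    have h3 : 4 * k * w + 1 ≤ (4 * k + 1) * ((s + 1) * (s + 1)) := by nlinarith
    calc 4 * k * w + 1 ≤ (4 * k + 1) * ((s + 1) * (s + 1)) := h3
      _ ≤ (s + 1) * ((s + 1) * (s + 1)) := Nat.mul_le_mul_right _ (by omega)
      _ = (s + 1) ^ 3 := by ring

theorem Inst.order_le {I : Inst} (h : I.Valid) : I.order ≤ 2 ^ (4 * I.w) := by
  have h1 := (primeSearch_spec (N := 2 ^ I.w) Nat.one_le_two_pow).2.2
  have h2 : I.p * I.choices ≤ (2 * 2 ^ I.w) * 2 ^ I.w := Nat.mul_le_mul h1 h.choices_le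
  have h3 := Nat.mul_le_mul_right (2 ^ I.w) h.k_le
  have h4 : 2 ≤ 2 ^ I.w := Nat.le_self_pow (by have := h.one_le_w; omega) 2
  have h5 : 2 ^ (4 * I.w) = (2 ^ I.w * 2 ^ I.w) * (2 ^ I.w * 2 ^ I.w) := by ring
  have h6 : 2 * 2 ≤ 2 ^ I.w * 2 ^ I.w := Nat.mul_le_mul h4 h4
  unfold order sets
  rw [h5]
  nlinarith

theorem Inst.two_le_order {I : Inst} (h : I.Valid) : 2 ≤ I.order := by
  have h3 := Nat.mul_le_mul_right (2 ^ I.w) h.one_le_k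
  have h4 : 2 ≤ 2 ^ I.w := Nat.le_self_pow (by have := h.one_le_w; omega) 2
  unfold order sets
  omega

/-- The main point is `choices`: from `q ^ (2 * k) ≤ w` there are at most `√w` tuples, and by
sparsity at most `2 ^ √w` clauses, so `m ^ q ^ k ≤ 2 ^ w`. -/
theorem CNF3.valid_toInst {n k w : ℕ} (φ : CNF3 n) (h : φ.AtMostThreeOccurrences) (hk : 1 ≤ k)
    (hw : 1 ≤ w) (hn : n ≤ k * w) (h1 : k + 1 ≤ 2 ^ w) (h2 : 4 * k * w + 1 ≤ 2 ^ Nat.sqrt w)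
    (h3 : (w + 2) ^ (2 * k) ≤ 2 ^ w) : (φ.toInst k w).Valid := by
  have hs : 2 ^ Nat.sqrt w ≤ 2 ^ w := Nat.pow_le_pow_right two_pos (Nat.sqrt_le_self w)
  have hm : φ.clauses.length ≤ 2 ^ Nat.sqrt w :=
    (φ.length_clauses_le h).trans (by nlinarith)
  refine ⟨hk, hw, by change k ≤ 2 ^ w; omega, hm.trans hs, h3, ?_, fun r => ?_⟩
  · have hq : (φ.toInst k w).q ^ k ≤ Nat.sqrt w := by
      rw [Nat.le_sqrt, ← pow_add, ← two_mul]
      exact (rootSearch_spec hk hw).2.1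
    refine (Nat.pow_le_pow_left hm _).trans ?_
    rw [← pow_mul]
    exact Nat.pow_le_pow_right two_pos ((Nat.mul_le_mul_left _ hq).trans (Nat.sqrt_le w))
  · exact (φ.input_lit_le r).trans (le_trans (by nlinarith) hs)

/-- The approximation guarantee yields a solution that is small enough to be accepted. -/
theorem four_mul_sq_lt {k w x q N : ℕ} (hN : N ≤ 2 ^ (4 * w)) (hN2 : 2 ≤ N)
    (hq : w < (q + 1) ^ (2 * k)) (hw : 4 * 5 ^ (4 * k) * k ^ (8 * k + 1) < w) (hq1 : 1 ≤ q)
    (hx : (x : ℝ) ≤ Real.logb 2 N ^ (1 / ((8 * k + 1 : ℕ) : ℝ)) * k) : 4 * x ^ 2 < q := by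
  by_contra! hc
  have hL : Real.logb 2 N ≤ 4 * w := by
    rw [Real.logb_le_iff_le_rpow one_lt_two (by positivity)]
    have : (N : ℝ) ≤ 2 ^ (4 * w) := by exact_mod_cast hN
    rw [← Real.rpow_natCast] at this
    exact_mod_cast this
  have hL0 : 0 ≤ Real.logb 2 N :=
    Real.logb_nonneg one_lt_two (by exact_mod_cast (by omega : 1 ≤ N))
  have hpow : x ^ (8 * k + 1) ≤ 4 * w * k ^ (8 * k + 1) := by
    have h1 := pow_le_pow_left₀ (Nat.cast_nonneg x) hx (8 * k + 1)
    rw [mul_pow, ← Real.rpow_mul_natCast hL0, one_div_mul_cancel (by positivity),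
      Real.rpow_one] at h1
    have h2 : (x : ℝ) ^ (8 * k + 1) ≤ 4 * w * k ^ (8 * k + 1) :=
      h1.trans (mul_le_mul_of_nonneg_right hL (by positivity))
    exact_mod_cast h2
  have hx1 : 1 ≤ x := Nat.pos_of_ne_zero fun h => by
    rw [h] at hc
    omega
  -- Since `q + 1 ≤ 5 * x ^ 2`, squaring bounds `w ^ 2` by a constant times `x ^ (8 * k)`, whereas
  -- the guarantee makes that power at most linear in `w`. This bounds `w`, against `hw`.
  have h1 : w < (5 * x ^ 2) ^ (2 * k) :=
    hq.trans_le (Nat.pow_le_pow_left (by nlinarith [Nat.pow_le_pow_left hx1 2]) _)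
  have h2 : w * w < 5 ^ (4 * k) * x ^ (8 * k) :=
    (Nat.mul_lt_mul'' h1 h1).trans_eq (by rw [mul_pow]; ring)
  have h3 : 5 ^ (4 * k) * x ^ (8 * k) ≤ 5 ^ (4 * k) * (4 * w * k ^ (8 * k + 1)) :=
    Nat.mul_le_mul_left _ ((Nat.pow_le_pow_right hx1 (Nat.le_succ _)).trans hpow)
  have h4 : w * w < 4 * 5 ^ (4 * k) * k ^ (8 * k + 1) * w := (h2.trans_le h3).trans_eq (by ring)
  exact lt_asymm hw (lt_of_mul_lt_mul_right h4 (Nat.zero_le w))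

/-! ### The program -/

/-- The number of variables per group. -/
def groupSize (k w₀ n : ℕ) : ℕ := w₀ + (n + k - 1) / k

theorem lt_ceil_iff {k n j : ℕ} (hk : 1 ≤ k) : j < (n + k - 1) / k ↔ n - j * k ≠ 0 := by
  rw [Nat.lt_iff_add_one_le, Nat.le_div_iff_mul_le hk, add_mul, one_mul]
  omega

theorem le_mul_groupSize {k n : ℕ} (hk : 1 ≤ k) (w₀ : ℕ) : n ≤ k * groupSize k w₀ n := by
  have h := (lt_ceil_iff (n := n) (j := (n + k - 1) / k) hk).not.1 (lt_irrefl _)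
  rw [groupSize, mul_add, mul_comm k ((n + k - 1) / k)]
  omega

theorem groupSize_le {k n : ℕ} (hk : 1 ≤ k) (w₀ : ℕ) :
    (groupSize k w₀ n : ℝ) ≤ w₀ + 1 + n / k := by
  have h : ((n + k - 1) / k : ℕ) ≤ (n / k : ℝ) + 1 := by
    have hk' : (0 : ℝ) < k := by exact_mod_cast hk
    refine Nat.cast_div_le.trans ?_
    rw [div_add_one hk'.ne']
    gcongr
    exact_mod_cast Nat.sub_le _ _
  rw [groupSize, Nat.cast_add]
  linarith

/-- The state in which the reduction starts, for the instance `I`. -/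
structure IsInitial (I : Inst) (s : State) : Prop where
  k : s.reg 0 = I.k
  w : s.reg 2 = I.w
  m : s.reg 4 = I.m
  odd : ∀ x, s.reg (2 * x + 1) = 0
  lit : s.arr 0 = I.lit
  arr : ∀ a i, s.arr (a + 1) i = 0

theorem exists_setup {k : ℕ} (hk : 1 ≤ k) (w₀ : ℕ) : ∃ R : Program, ∀ n (φ : CNF3 n),
    Runs R φ.input (10 * groupSize k w₀ n + 18) (IsInitial (φ.toInst k (groupSize k w₀ n))) := by
  -- Register `1` is cleared because odd registers belong to the guest. Subtracting `k` from `n`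
  -- until `0` is reached takes `⌈n / k⌉` rounds, each adding `1` to the group size.
  refine ⟨.seq (.assign 4 (.var 1)) (.seq (.assign 1 (.const 0)) (.seq (.assign 2 (.const w₀))
    (.seq (.loop (.var 0) (.seq (.assign 0 (.sub (.var 0) (.const k)))
      (.assign 2 (.add (.var 2) (.const 1))))) (.assign 0 (.const k))))), fun n φ => ?_⟩
  set b := (n + k - 1) / k
  let Inv : ℕ → State → Prop := fun j s => s.reg 0 = n - j * k ∧ s.reg 2 = w₀ + j ∧
    s.reg 4 = φ.clauses.length ∧ (∀ x, s.reg (2 * x + 1) = 0) ∧ s.arr = φ.input.arr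
  have harr : ∀ a i, φ.input.arr (a + 1) i = 0 := fun a i => by simp [CNF3.input]
  refine Runs.mono (Runs.seq (Runs.assign (Q := fun s => s.reg 0 = n ∧
    s.reg 4 = φ.clauses.length ∧ (∀ x, s.reg (2 * (x + 1) + 1) = 0) ∧ s.arr = φ.input.arr) ?_)
    fun s1 h1 => Runs.seq (Runs.assign (Q := fun s => s.reg 0 = n ∧
      s.reg 4 = φ.clauses.length ∧ (∀ x, s.reg (2 * x + 1) = 0) ∧ s.arr = φ.input.arr) ?_)
    fun s2 h2 => Runs.seq (Runs.assign (Q := Inv 0) ?_) fun s3 h3 => Runs.seq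
      (Runs.loop (K := 8) (b := b) Inv (fun j s _ hs => ?_) (fun j s _ hs => ?_) h3)
    fun s4 h4 => Runs.assign (Q := IsInitial (φ.toInst k (groupSize k w₀ n))) ?_) ?_ fun _ h => h
  · refine ⟨by simp [State.setReg, CNF3.input], by simp [State.setReg, CNF3.input, Expr.eval],
      fun x => ?_, rfl⟩
    simp only [State.setReg]
    rw [Function.update_of_ne (by omega)]
    simp [CNF3.input]
  · refine ⟨by simp [State.setReg, h1.1], by simp [State.setReg, h1.2.1], fun x => ?_, h1.2.2.2⟩
    cases x with
    | zero => simp [State.setReg, Expr.eval]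
    | succ x =>
      simp only [State.setReg]
      rw [Function.update_of_ne (by omega), h1.2.2.1]
  · refine ⟨by simp [State.setReg, h2.1], by simp [State.setReg, Expr.eval],
      by simp [State.setReg, h2.2.1], fun x => ?_, h2.2.2.2⟩
    simp only [State.setReg]
    rw [Function.update_of_ne (by omega), h2.2.2.1]
  · rw [lt_ceil_iff hk, ← hs.1]
    rfl
  · refine Runs.seq (K := 4) (K' := 4) (Runs.assign (Q := fun s => s.reg 0 = n - (j + 1) * k ∧
      s.reg 2 = w₀ + j ∧ s.reg 4 = φ.clauses.length ∧ (∀ x, s.reg (2 * x + 1) = 0) ∧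
      s.arr = φ.input.arr) ⟨?_, ?_, ?_, fun x => ?_, hs.2.2.2.2⟩) fun t ht =>
        Runs.assign ⟨?_, ?_, ?_, fun x => ?_, ht.2.2.2.2⟩
    · simp only [State.setReg, Expr.eval, hs.1, Function.update_self, add_mul]
      omega
    · simp [State.setReg, hs.2.1]
    · simp [State.setReg, hs.2.2.1]
    · simp only [State.setReg]
      rw [Function.update_of_ne (by omega), hs.2.2.2.1]
    · simp [State.setReg, ht.1]
    · simp [State.setReg, Expr.eval, ht.2.1, add_assoc]
    · simp [State.setReg, ht.2.2.1]
    · simp only [State.setReg]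
      rw [Function.update_of_ne (by omega), ht.2.2.2.1]
  · refine ⟨rfl, by simp [State.setReg, h4.2.1, groupSize, CNF3.toInst, b],
      by simp [State.setReg, h4.2.2.1, CNF3.toInst], fun x => ?_, ?_, fun a i => ?_⟩
    · simp only [State.setReg]
      rw [Function.update_of_ne (by omega), h4.2.2.2.1]
    · simp [State.setReg, h4.2.2.2.2, CNF3.toInst]
    · simp [State.setReg, h4.2.2.2.2, harr]
  · simp only [Expr.cost, groupSize]
    omega

theorem IsInitial.holds {I : Inst} {s : State} (h : IsInitial I s) (hI : I.Valid) :
    instCtx.Holds id I s := by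
  refine ⟨fun i hi => ?_, h.lit, hI⟩
  change i < 3 at hi
  interval_cases i
  · exact h.k
  · exact h.w
  · exact h.m

open Classical in
/-- The entries of the adjacency matrix, row by row. -/
noncomputable def Inst.entry (I : Inst) (i : ℕ) : ℕ :=
  if I.Adjacent (i / I.order) (i % I.order) then 1 else 0

theorem Inst.domInput_arr (I : Inst) (k i : ℕ) :
    (domInput I.graph k).arr 0 i = if i < I.order * I.order then I.entry i else 0 := by
  have hiff : (∃ u v : Fin I.order, I.graph.Adj u v ∧ i = u.val * I.order + v.val) ↔
      i < I.order * I.order ∧ I.Adjacent (i / I.order) (i % I.order) := by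
    constructor
    · rintro ⟨u, v, h, rfl⟩
      have hpos := (Nat.zero_le _).trans_lt u.2
      rw [mul_comm, Nat.mul_add_div hpos, Nat.div_eq_of_lt v.2, add_zero, Nat.mul_add_mod,
        Nat.mod_eq_of_lt v.2]
      refine ⟨?_, h⟩
      have h1 := Nat.mul_le_mul_left I.order (Nat.succ_le_of_lt u.2)
      have h2 := v.2
      rw [Nat.mul_succ] at h1
      omega
    · rintro ⟨hi, h⟩
      have hpos : 0 < I.order := Nat.pos_of_ne_zero fun h0 => by simp [h0] at hi
      exact ⟨⟨_, Nat.div_lt_of_lt_mul hi⟩, ⟨_, Nat.mod_lt i hpos⟩, h,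
        (Nat.div_add_mod' i I.order).symm⟩
  classical
  refine (if_congr ((and_iff_right rfl).trans hiff) rfl rfl).trans ?_
  by_cases h1 : i < I.order * I.order <;> simp [h1, entry]

/-- The state is ready for an algorithm, as a guest, to be run on the graph of the instance. -/
def IsPrepared (I : Inst) (s : State) : Prop :=
  instCtx.Holds id I s ∧ s.guest = domInput I.graph I.k

theorem feasible_entry : Feasible (instCtx.push fun I => I.order * I.order)
    (fun p => p.1.entry p.2) := by
  have hX := describes_instCtx.push fun I => I.order * I.order
  have hi := Feasible.snd (X := instCtx) (describes_instCtx.order.mul describes_instCtx.order).1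
  exact hX.adjacent (hi.div hX.order) (hi.mod hX.order)

theorem lay_lt_three : ∀ i < instCtx.depth, id i < 3 := fun _ hi => hi

theorem Ctx.Holds.of_agree {I : Inst} {s s' : State} (h : instCtx.Holds id I s)
    (hr : ∀ x < 3, s'.reg (2 * x) = s.reg (2 * x)) (ha : s'.arr 0 = s.arr 0) :
    instCtx.Holds id I s' :=
  ⟨fun i hi => (hr i hi).trans (h.1 i hi), ha.trans h.2.1, h.2.2⟩

theorem exists_prepare : ∃ D : Inst → ℕ, instCtx.PolyBdd D ∧ ∃ R : Program, ∀ I s,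
    I.Valid → IsInitial I s → Runs R s (D I) (IsPrepared I) := by
  obtain ⟨-, c, hc, hP⟩ := describes_instCtx.order
  obtain ⟨hbb, d, hd, hQ⟩ := describes_instCtx.order.mul describes_instCtx.order
  obtain ⟨-, f, ⟨C, hC⟩, hE⟩ := feasible_entry
  obtain ⟨P, hP⟩ := hP id 3 lay_lt_three
  obtain ⟨Q, hQ⟩ := hQ id 4 fun i hi => (lay_lt_three i hi).trans (by omega)
  obtain ⟨E, hE⟩ := hE (Function.update id 3 5) 6
    (Ctx.lay_push _ (fun i hi => (lay_lt_three i hi).trans (by omega)) (by omega))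
  -- Register `6` receives the order, `8` its square, `10` the position in the matrix, `12` the
  -- entry. Registers `1` and `3` and array `1` are the guest's registers `0` and `1` and array `0`.
  refine ⟨fun I => c I + (2 + (2 + (d I + (2 + ((I.order * I.order + 1) *
      ((2 ^ I.w + 2) ^ C + (3 + 4) + 3 + 1)))))), ?_,
    .seq P (.seq (.assign 1 (.var 6)) (.seq (.assign 3 (.var 0)) (.seq Q (.seq
      (.assign 10 (.const 0)) (.loop (.sub (.var 8) (.var 10))
        (.seq E (.seq (.write 1 (.var 10) (.var 12))
          (.assign 10 (.add (.var 10) (.const 1)))))))))), fun I s hI hs => ?_⟩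
  · exact hc.add (.add (.const _) (.add (.const _) (hd.add (.add (.const _) (.mul (hbb.add
      (.const 1)) (.add (.add (.add ⟨C, fun _ _ _ => le_rfl⟩ (.const _)) (.const _))
        (.const _)))))))
  let Inv : ℕ → State → Prop := fun j t => instCtx.Holds id I t ∧
    t.reg 8 = I.order * I.order ∧ t.reg 10 = j ∧
    (∀ x, t.reg (2 * x + 1) = (domInput I.graph I.k).reg x) ∧
    (∀ i, t.arr 1 i = if i < j then I.entry i else 0) ∧ ∀ a i, t.arr (a + 2) i = 0
  have hh := hs.holds hI
  refine Runs.seq (hP I s hh) fun s1 h1 => ?_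
  have hh1 := hh.of_sameBelow lay_lt_three h1.2
  refine Runs.seq (Runs.assign (Q := fun t => instCtx.Holds id I t ∧ t.reg 1 = I.order ∧
    (∀ x, t.reg (2 * (x + 1) + 1) = 0) ∧ t.arr = s.arr) ⟨?_, ?_, ?_, h1.2.2⟩) fun s2 h2 => ?_
  · exact hh1.of_agree (fun x hx => Function.update_of_ne (by omega) _ _) rfl
  · simp [State.setReg, Expr.eval, h1.1]
  · intro x
    simp only [State.setReg]
    rw [Function.update_of_ne (by omega), h1.2.1 _ (Or.inr (by omega)), hs.odd]
  refine Runs.seq (Runs.assign (Q := fun t => instCtx.Holds id I t ∧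
    (∀ x, t.reg (2 * x + 1) = (domInput I.graph I.k).reg x) ∧ t.arr = s.arr)
      ⟨?_, fun x => ?_, h2.2.2.2⟩) fun s3 h3 => ?_
  · exact h2.1.of_agree (fun x hx => Function.update_of_ne (by omega) _ _) rfl
  · have hk : s2.reg 0 = I.k := h2.1.1 0 (by simp [instCtx])
    simp only [State.setReg, Expr.eval, hk, domInput]
    rcases x with _ | _ | x
    · simp [h2.2.1]
    · simp
    · rw [Function.update_of_ne (by omega), h2.2.2.1]
      simp
  refine Runs.seq (hQ I s3 h3.1) fun s4 h4 => ?_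
  have hh4 := h3.1.of_sameBelow (fun i hi => (lay_lt_three i hi).trans (by omega)) h4.2
  refine Runs.seq (R := Inv 0) (Runs.assign ⟨?_, ?_, ?_, fun x => ?_, fun i => ?_, fun a i => ?_⟩)
    fun s5 h5 => ?_
  · exact hh4.of_agree (fun x hx => Function.update_of_ne (by omega) _ _) rfl
  · simpa [State.setReg] using h4.1
  · simp [State.setReg, Expr.eval]
  · simp only [State.setReg]
    rw [Function.update_of_ne (by omega), h4.2.1 _ (Or.inr (by omega)), h3.2.1]
  · simp [State.setReg, h4.2.2, h3.2.2, hs.arr 0]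
  · simp [State.setReg, h4.2.2, h3.2.2, hs.arr (a + 1)]
  refine (Runs.loop (K := (2 ^ I.w + 2) ^ C + (3 + 4)) (b := I.order * I.order) Inv
    (fun j t _ ht => ?_) (fun j t hj ht => ?_) h5).mono le_rfl fun t ht => ⟨ht.1, ?_⟩
  · simp only [Expr.eval, ht.2.1, ht.2.2.1]
    omega
  · obtain ⟨t1, t2, t3, t4, t5, t6⟩ := ht
    have hp := t1.push (b := fun I => I.order * I.order) (e := 5) t3 hj
    refine Runs.seq ((hE _ t hp).mono (hC _ _ hp.2) fun _ h => h) fun u hu => ?_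
    have hu1 := t1.of_sameBelow (fun i hi => (lay_lt_three i hi).trans (by omega)) hu.2
    refine Runs.seq (R := fun v => instCtx.Holds id I v ∧
      v.reg 8 = I.order * I.order ∧ v.reg 10 = j ∧
      (∀ x, v.reg (2 * x + 1) = (domInput I.graph I.k).reg x) ∧
      (∀ i, v.arr 1 i = if i < j + 1 then I.entry i else 0) ∧ ∀ a i, v.arr (a + 2) i = 0)
      (Runs.write ⟨?_, ?_, ?_, fun x => ?_, fun i => ?_, fun a i => ?_⟩) fun v hv =>
        Runs.assign ⟨?_, ?_, ?_, fun x => ?_, hv.2.2.2.2⟩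
    · exact hu1.of_agree (fun x hx => rfl) (by simp [State.setArr])
    · exact (hu.2.reg (y := 4) (by omega)).trans t2
    · exact (hu.2.reg (y := 5) (by omega)).trans t3
    · exact (hu.2.1 _ (Or.inr (by omega))).trans (t4 x)
    · have hj10 : u.reg 10 = j := (hu.2.reg (y := 5) (by omega)).trans t3
      have h12 : u.reg 12 = I.entry j := hu.1
      simp only [State.setArr, Expr.eval, Function.update_self, hj10, h12, hu.2.2]
      by_cases hij : i = j
      · simp [hij]
      · rw [Function.update_of_ne hij, t5]
        exact if_congr (by omega) rfl rfl
    · simp [State.setArr, hu.2.2, t6]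
    · exact hv.1.of_agree (fun x hx => Function.update_of_ne (by omega) _ _) rfl
    · simp [State.setReg, hv.2.1]
    · simp [State.setReg, Expr.eval, hv.2.2.1]
    · simp only [State.setReg]
      rw [Function.update_of_ne (by omega), hv.2.2.2.1]
  · have hreg : t.guest.reg = (domInput I.graph I.k).reg := funext ht.2.2.2.1
    have harr : t.guest.arr = (domInput I.graph I.k).arr := by
      funext a i
      rcases a with _ | a
      · rw [I.domInput_arr, ← ht.2.2.2.2.1]
        rfl
      · refine (ht.2.2.2.2.2 a i).trans ?_
        simp [domInput]
    calc t.guest = ⟨t.guest.reg, t.guest.arr⟩ := rfl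
      _ = domInput I.graph I.k := by rw [hreg, harr]

/-- Array `2` is the guest's array `1`, in which the approximation algorithm leaves its output. -/
theorem exists_check : ∃ D : Inst → ℕ, instCtx.PolyBdd D ∧ ∃ R : Program, ∀ I s,
    instCtx.Holds id I s → Runs R s (D I) (fun s' => s'.reg 0 ≠ 0 ↔ I.Accepts (s.arr 2)) := by
  obtain ⟨-, c, ⟨C, hC⟩, hP⟩ := describes_outCtx.accepts 2 fun _ _ h => h.2
  obtain ⟨P, hP⟩ := hP id 3 lay_lt_three
  refine ⟨fun I => (2 ^ I.w + 2) ^ C + 2, .add ⟨C, fun _ _ _ => le_rfl⟩ (.const 2),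
    .seq P (.assign 0 (.var 6)), fun I s hs => ?_⟩
  have hh : outCtx.Holds id (I, s.arr 2) s := ⟨hs.1, hs.2, rfl⟩
  refine Runs.seq ((hP _ s hh).mono (hC _ _ hh.2) fun _ h => h) fun t ht => Runs.assign ?_
  have h6 : t.reg 6 = _ := ht.1
  simp [State.setReg, Expr.eval, h6]

/-- The algorithm for 3-SAT obtained from an algorithm for dominating sets. -/
theorem exists_reduction : ∃ C : ℕ, ∀ (k w₀ : ℕ) (P : Program), 1 ≤ k → ∃ R : Program,
    ∀ (n : ℕ) (φ : CNF3 n) (w : ℕ), w = groupSize k w₀ n → (φ.toInst k w).Valid →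
      ∀ c t, Exec P (domInput (φ.toInst k w).graph k) c t →
        Runs R φ.input ((2 ^ w + 2) ^ C + c)
          (fun s => s.reg 0 ≠ 0 ↔ (φ.toInst k w).Accepts (t.arr 1)) := by
  obtain ⟨D, hD, Q, hQ⟩ := exists_prepare
  obtain ⟨E, hE, S, hS⟩ := exists_check
  obtain ⟨C, hC⟩ := (((Ctx.PolyBdd.const (X := instCtx) 10).mul describes_instCtx.w.1).add
    (.const 18)).add (hD.add hE)
  refine ⟨C, fun k w₀ P hk => ?_⟩
  obtain ⟨R, hR⟩ := exists_setup hk w₀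
  refine ⟨.seq R (.seq Q (.seq P.toGuest S)), fun n φ w hw hv c t hP => ?_⟩
  subst hw
  refine Runs.mono ((hR n φ).seq fun s1 h1 => (hQ _ s1 hv h1).seq fun s2 h2 =>
    Runs.seq (K := c) (R := fun s => instCtx.Holds id (φ.toInst k (groupSize k w₀ n)) s ∧
      s.guest = t) ?_ fun s3 h3 => (hS _ s3 h3.1).mono (Q' := fun s => s.reg 0 ≠ 0 ↔
      (φ.toInst k (groupSize k w₀ n)).Accepts (t.arr 1)) le_rfl fun s h => by
        rw [← h3.2]; exact h) ?_ fun _ h => h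
  · obtain ⟨s3, h3, h4, h5⟩ := hP.toGuest s2 h2.2
    exact ⟨c, s3, h3, le_rfl, h2.1.of_agree (fun x _ => h5.1 x) h5.2, h4⟩
  · have := hC (φ.toInst k (groupSize k w₀ n)) (fun _ => φ.input.arr 0) ⟨rfl, hv⟩
    change 10 * groupSize k w₀ n + 18 + (D _ + E _) ≤ (2 ^ groupSize k w₀ n + 2) ^ C at this
    omega

theorem Inst.accepts_of_isDominating {I : Inst} {s : State}
    (h : IsDominating I.graph (outputSet I.order s))
    (hq : 4 * (outputSet I.order s).card ^ 2 < I.q) : I.Accepts (s.arr 1) := by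
  constructor
  · convert hq using 3
    rw [← Finset.card_map Fin.valEmbedding]
    congr 1
    ext v
    simp only [Finset.mem_filter, Finset.mem_range, Finset.mem_map, outputSet, Finset.mem_univ,
      true_and, Fin.valEmbedding_apply]
    constructor
    · rintro ⟨hv, h0⟩
      exact ⟨⟨v, hv⟩, h0, rfl⟩
    · rintro ⟨u, h0, rfl⟩
      exact ⟨u.2, h0⟩
  · intro v hv
    have hmem : ∀ u : Fin I.order, u ∈ outputSet I.order s ↔ s.arr 1 u ≠ 0 := by
      simp [outputSet]
    by_cases h0 : s.arr 1 v = 0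
    · obtain ⟨u, hu, hadj⟩ := h ⟨v, hv⟩ fun h' => (hmem _).1 h' h0
      exact Or.inr ⟨u, u.2, (hmem u).1 hu, hadj⟩
    · exact Or.inl h0

/-- From an approximation algorithm for dominating sets, one obtains for every `k` an algorithm for
3-SAT with few occurrences. -/
theorem exists_decides : ∃ C : ℕ, ∀ (P : Program) (k : ℕ) (T g : ℝ), 1 ≤ k → 0 ≤ T →
    (∀ (n : ℕ) (G : SimpleGraph (Fin n)), 2 ≤ n → ∃ (c : ℕ) (s : State),
      Exec P (domInput G k) c s ∧ (c : ℝ) ≤ T * (n : ℝ) ^ g ∧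
        ((∃ S : Finset (Fin n), IsDominating G S ∧ S.card ≤ k) →
          IsDominating G (outputSet n s) ∧ ((outputSet n s).card : ℝ) ≤
            Real.logb 2 (n : ℝ) ^ (1 / ((8 * k + 1 : ℕ) : ℝ)) * (k : ℝ))) →
    ∃ (R : Program) (w₀ : ℕ), Decides3SAT R (fun _ φ => φ.AtMostThreeOccurrences) (fun n =>
      (2 : ℝ) ^ ((C : ℝ) * groupSize k w₀ n) + T * (2 : ℝ) ^ (4 * |g| * groupSize k w₀ n)) := by
  obtain ⟨C, hC⟩ := exists_reduction
  -- The factor `2` comes from `2 ^ w + 2 ≤ 2 ^ (2 * w)`.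
  refine ⟨2 * C, fun P k T g hk hT hP => ?_⟩
  obtain ⟨w₀, hw₀, hlarge⟩ := exists_large k
  obtain ⟨R, hR⟩ := hC k w₀ P hk
  refine ⟨R, w₀, fun n φ hφ => ?_⟩
  set w := groupSize k w₀ n with hw
  have hww : w₀ ≤ w := Nat.le_add_right _ _
  obtain ⟨h1, h2, h3, h4⟩ := hlarge w hww
  have hw1 : 1 ≤ w := hw₀.trans hww
  have hv := φ.valid_toInst hφ hk hw1 (le_mul_groupSize hk w₀) h1 h2 h3
  have hord := Inst.order_le hv
  have hord2 := Inst.two_le_order hv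
  set I := φ.toInst k w
  obtain ⟨c, t, hex, hct, happ⟩ := hP I.order I.graph hord2
  obtain ⟨c', s, hex', hc', hs⟩ := hR n φ w hw hv c t hex
  refine ⟨c', s, hex', ?_, hs.trans ⟨fun h => ?_, fun h => ?_⟩⟩
  · have h5 : (2 ^ w + 2) ^ C ≤ 2 ^ (2 * C * w) := by
      have h6 : 2 ≤ 2 ^ w := Nat.le_self_pow (by omega) 2
      calc (2 ^ w + 2) ^ C ≤ (2 ^ w * 2 ^ w) ^ C := Nat.pow_le_pow_left (by nlinarith) _
        _ = 2 ^ (2 * C * w) := by rw [← pow_add, ← pow_mul]; ring_nf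
    have h7 : ((2 ^ w + 2 : ℕ) : ℝ) ^ C ≤ (2 : ℝ) ^ (((2 * C : ℕ) : ℝ) * w) := by
      rw [← Nat.cast_mul, Real.rpow_natCast]
      exact_mod_cast h5
    have h8 : (I.order : ℝ) ^ g ≤ (2 : ℝ) ^ (4 * |g| * w) := by
      have h9 : (1 : ℝ) ≤ I.order := by exact_mod_cast (by omega : 1 ≤ I.order)
      have h10 : (I.order : ℝ) ≤ (2 : ℝ) ^ (4 * (w : ℝ)) := by
        have : (I.order : ℝ) ≤ (2 : ℝ) ^ (4 * w) := by exact_mod_cast hord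
        rw [← Real.rpow_natCast] at this
        exact_mod_cast this
      calc (I.order : ℝ) ^ g ≤ (I.order : ℝ) ^ |g| :=
            Real.rpow_le_rpow_of_exponent_le h9 (le_abs_self g)
        _ ≤ ((2 : ℝ) ^ (4 * (w : ℝ))) ^ |g| :=
            Real.rpow_le_rpow (by positivity) h10 (abs_nonneg g)
        _ = (2 : ℝ) ^ (4 * |g| * w) := by
            rw [← Real.rpow_mul two_pos.le]
            ring_nf
    calc (c' : ℝ) ≤ ((2 ^ w + 2 : ℕ) : ℝ) ^ C + c := by exact_mod_cast hc'
      _ ≤ _ := add_le_add h7 (hct.trans (mul_le_mul_of_nonneg_left h8 hT))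
  -- An accepted output certifies satisfiability by itself, so nothing is asked of `P` on graphs
  -- without a small dominating set.
  · exact (φ.satisfiable_iff k w).2 (Inst.exists_isModel_of_accepts hk hw1 h)
  · obtain ⟨β, hβ⟩ := (φ.satisfiable_iff k w).1 h
    obtain ⟨hdom, hcard⟩ := happ (Inst.exists_isDominating hβ hk hw1 fun r hr =>
      (φ.input_lit_var_lt hr).trans_le (le_mul_groupSize hk w₀))
    have hroot := rootSearch_spec hk hw1
    exact Inst.accepts_of_isDominating hdom (four_mul_sq_lt hord hord2 hroot.2.2 h4 hroot.1 hcard)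

/-- The group size exceeds `n / k` by at most `w₀ + 1`, so the rate per variable is `E / k ≤ δ`, and
the padding costs a constant factor. -/
theorem two_rpow_groupSize_le {k : ℕ} (hk : 1 ≤ k) (w₀ n : ℕ) {E δ : ℝ} (hE : 0 ≤ E)
    (h : E ≤ δ * k) :
    (2 : ℝ) ^ (E * groupSize k w₀ n) ≤ (2 : ℝ) ^ (E * (w₀ + 1)) * (2 : ℝ) ^ (δ * n) := by
  rw [← Real.rpow_add two_pos]
  refine Real.rpow_le_rpow_of_exponent_le one_le_two ?_
  have hk' : (0 : ℝ) < k := by exact_mod_cast hk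
  have h1 := mul_le_mul_of_nonneg_left (groupSize_le (n := n) hk w₀) hE
  have h2 : E * (n / k : ℝ) ≤ δ * n := by
    rw [mul_div_assoc', div_le_iff₀ hk']
    nlinarith [Nat.cast_nonneg (α := ℝ) n]
  linarith

end DomETH

theorem theorem2 :
    DomETH.ETH →
      ∃ p : Polynomial ℕ, (∀ k : ℕ, 0 < p.eval k) ∧
        ∀ (T : ℕ → ℕ) (g : ℕ → ℝ), g =o[atTop] (fun k : ℕ => (k : ℝ)) →
          ¬ ∃ P : DomETH.Program,
            DomETH.ApproximatesDomSet P
              (fun n k => Real.logb 2 (n : ℝ) ^ (1 / ((p.eval k : ℕ) : ℝ)))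
              (fun n k => (T k : ℝ) * (n : ℝ) ^ g k) := by
  rintro ⟨δ, hδ, -, hno⟩
  have heval : ∀ k : ℕ, (8 * Polynomial.X + 1 : Polynomial ℕ).eval k = 8 * k + 1 := by simp
  -- The summand `1` makes the polynomial positive at `0`.
  refine ⟨8 * Polynomial.X + 1, fun k => by rw [heval]; omega, ?_⟩
  rintro T g hg ⟨P, hP⟩
  simp only [DomETH.ApproximatesDomSet, heval] at hP
  obtain ⟨C, hC⟩ := DomETH.exists_decides
  have hlarge : ∀ᶠ k : ℕ in atTop, (C : ℝ) ≤ δ * k :=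
    (tendsto_natCast_atTop_atTop.const_mul_atTop hδ).eventually_ge_atTop _
  -- Since `C` does not depend on `k`, it can be absorbed by a large `k`; the `4` in `δ / 4` comes
  -- from the order `2 ^ (4 * w)` of the graph. With `k` fixed, `T k` is just a constant, so
  -- computability of `T` plays no role.
  obtain ⟨k, hk, hkC, hkg⟩ := ((eventually_ge_atTop 1).and (hlarge.and
    (hg.bound (show 0 < δ / 4 by positivity)))).exists
  rw [Real.norm_eq_abs, Real.norm_eq_abs, Nat.abs_cast] at hkg
  obtain ⟨R, w₀, hR⟩ := hC P k (T k) (g k) hk (Nat.cast_nonneg _) fun n G hn => hP n k G hn hk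
  refine hno ⟨R, (2 : ℝ) ^ ((C : ℝ) * (w₀ + 1)) + T k * (2 : ℝ) ^ (4 * |g k| * (w₀ + 1)),
    fun n φ hφ => ?_⟩
  obtain ⟨c, s, h1, h2, h3⟩ := hR n φ hφ
  refine ⟨c, s, h1, h2.trans ?_, h3⟩
  have e1 := DomETH.two_rpow_groupSize_le hk w₀ n (Nat.cast_nonneg C) hkC
  have e2 := DomETH.two_rpow_groupSize_le (E := 4 * |g k|) (δ := δ) hk w₀ n (by positivity)
    (by linarith)
  have e3 := mul_le_mul_of_nonneg_left e2 (Nat.cast_nonneg (α := ℝ) (T k))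
  beta_reduce
  rw [add_mul, mul_assoc (T k : ℝ)]
  exact add_le_add e1 e3
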